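/- Let $F(x)=e^{-|x|}$ for $x\in(-1,1)$, and let $\mathscr H_F$ be the reproducing kernel Hilbert space of functions on $(0,1)$ with kernel $K(x,y)=F(x-y)$, i.e. the completion of the span of the functions $F(\cdot-y)$, $y\in(0,1)$, with respect to $\langle F(\cdot-x),F(\cdot-y)\rangle_{\mathscr H_F}=F(x-y)$. For $\varphi\in C_c^\infty(0,1)$ put $F_\varphi(x)=\int_0^1\varphi(y)F(x-y)\,dy$; let $D_F$ be the operator in $\mathscr H_F$ with domain $\{F_\varphi:\varphi\in C_c^\infty(0,1)\}$ and $D_F(F_\varphi)=F_{\varphi'}$. For $\theta\in[0,2\pi)$ let $A_\theta$ be the operator in $\mathscr H_F$ given by $$A_\theta\bigl(h+c\,(e^{-x}+e^{i\theta}e^{x-1})\bigr)=\overline{(-iD_F)}\,h+ic\,(e^{-x}-e^{i\theta}e^{x-1}),\qquad h\in \mathrm{dom}\,\overline{D_F},\ c\in\mathbb C,$$ where the bar denotes the closure of an operator. Then the operators $A_\theta$, $\theta\in[0,2\pi)$, are exactly the selfadjoint extensions of $-iD_F$ in $\mathscr H_F$. For every $\lambda\in\mathbb R$ the function $e_\lambda(x)=e^{i\lambda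 x}$ belongs to $\mathscr H_F$. Moreover, for every $\theta\in[0,2\pi)$, the spectrum $\Lambda_\theta$ of $A_\theta$ is contained in $\mathbb R$, and: 1. if $\lambda,\mu\in\Lambda_\theta$ and $\lambda\ne\mu$, then $\langle e_\lambda,e_\mu\rangle_{\mathscr H_F}=0$; 2. $\bigl\{\sqrt{2/(\lambda^2+3)}\;e_\lambda:\lambda\in\Lambda_\theta\bigr\}$ is an orthonormal basis of $\mathscr H_F$; 3. $\Lambda_\theta$ is not contained in any arithmetic progression $\{a+nd:n\in\mathbb Z\}$, $a,d\in\mathbb R$; 4. the system $\{e_\lambda:\lambda\in\Lambda_\theta\}$ is not orthogonal in $L^2(0,1)$: there are $\lambda\ne\mu$ in $\Lambda_\theta$ with $\int_0^1\overline{e_\lambda(x)}\,e_\mu(x)\,dx\neq0$. -/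

import Mathlib

noncomputable section

namespace ExpKernel

open Set Filter Topology MeasureTheory ComplexConjugate
open scoped ContDiff InnerProductSpace

/-- The function `F(x) = e^{-|x|}`; only its values on `(-1,1)` are used below. -/
def F (x : ℝ) : ℂ := ((Real.exp (-|x|) : ℝ) : ℂ)

/-- The interval `Ω = (0,1)`. -/
abbrev Ω : Set ℝ := Set.Ioo 0 1

/-- The kernel `K(x,y) = F(x-y)` on `(0,1) × (0,1)`, each scalar acting on `ℂ` by
multiplication. -/
def K : Matrix Ω Ω (ℂ →L[ℂ] ℂ) :=
  Matrix.of fun x y => F (x.1 - y.1) • ContinuousLinearMap.id ℂ ℂ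

lemma K_apply (x y : Ω) (v : ℂ) : K x y v = F (x.1 - y.1) * v := by
  simp [K]

/-- A feature vector whose Gram matrix is `F(x-y)`. -/
def feat (x : ℝ) : Lp ℂ 2 (volume : Measure ℝ) :=
  ((Real.exp (-x) : ℝ) : ℂ) •
    indicatorConstLp 2 (measurableSet_Ioc (a := (0 : ℝ)) (b := Real.exp (2 * x)))
      (by simp) (1 : ℂ)

lemma inner_feat (x y : ℝ) : ⟪feat x, feat y⟫_ℂ = F (x - y) := by
  have hmin : (0 : ℝ) ≤ min (Real.exp (2 * x)) (Real.exp (2 * y)) :=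
    le_min (Real.exp_pos _).le (Real.exp_pos _).le
  have key : Real.exp (-x) * (Real.exp (-y) * min (Real.exp (2 * x)) (Real.exp (2 * y)))
      = Real.exp (-|x - y|) := by
    rcases le_total x y with h | h
    · rw [min_eq_left (Real.exp_le_exp.2 (by linarith)), ← Real.exp_add, ← Real.exp_add,
        abs_of_nonpos (by linarith)]
      congr 1; ring
    · rw [min_eq_right (Real.exp_le_exp.2 (by linarith)), ← Real.exp_add, ← Real.exp_add,
        abs_of_nonneg (by linarith)]
      congr 1; ring
  rw [feat, feat, inner_smul_left, inner_smul_right,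
    L2.inner_indicatorConstLp_one_indicatorConstLp_one _ _ (by simp) (by simp),
    Set.Ioc_inter_Ioc, Complex.conj_ofReal, F, ← key, Measure.real, Real.volume_Ioc, max_self,
    sub_zero, ENNReal.toReal_ofReal hmin]
  push_cast
  rfl

/-- `F` is positive definite. -/
theorem K_posSemidef : K.PosSemidef := by
  have tfae := (RKHS.posSemidef_tfae (K := K)).out 0 1
  refine tfae.2 ⟨?_, fun f => ?_⟩
  · ext x y
    have h1 : star (ContinuousLinearMap.id ℂ ℂ) = ContinuousLinearMap.id ℂ ℂ :=
      star_one (ℂ →L[ℂ] ℂ)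
    simp only [Matrix.conjTranspose_apply, K, Matrix.of_apply, F, abs_sub_comm y.1 x.1,
      star_smul, h1]
    rw [RCLike.star_def, Complex.conj_ofReal]
  · let w : Lp ℂ 2 (volume : Measure ℝ) := f.sum fun xv z => (z * xv.2) • feat xv.1.1
    have h : (f.sum fun xv z => f.sum fun xv' u =>
        conj z * u * ⟪K xv'.1 xv.1 xv.2, xv'.2⟫_ℂ) = ⟪w, w⟫_ℂ := by
      simp only [w, Finsupp.sum, sum_inner, inner_sum]
      rw [Finset.sum_comm]
      refine Finset.sum_congr rfl fun b _ => Finset.sum_congr rfl fun a _ => ?_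
      rw [inner_smul_left, inner_smul_right, inner_feat, K_apply]
      have hF : conj (F (b.1.1 - a.1.1)) = F (a.1.1 - b.1.1) := by
        simp only [F, Complex.conj_ofReal, abs_sub_comm]
      simp only [RCLike.inner_apply, map_mul, hF]
      ring
    rw [h]
    exact inner_self_nonneg

instance : Fact K.PosSemidef := ⟨K_posSemidef⟩

/-- The reproducing kernel Hilbert space `H_F` of functions on `(0,1)`: the completion of the
span of the kernel functions `F(· - y)`, `y ∈ (0,1)`. -/
abbrev HF : Type := RKHS.OfKernel K

/-- `φ ∈ C_c^∞(0,1)`. -/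
structure IsTest (φ : ℝ → ℂ) : Prop where
  smooth : ContDiff ℝ ∞ φ
  compact : HasCompactSupport φ
  supp : tsupport φ ⊆ Ω

/-- `F_φ(x) = ∫_0^1 φ(y) F(x-y) dy`. -/
def Fint (φ : ℝ → ℂ) (x : ℝ) : ℂ := ∫ y in (0 : ℝ)..1, φ y * F (x - y)

lemma IsTest.deriv {φ : ℝ → ℂ} (h : IsTest φ) : IsTest (deriv φ) where
  smooth := (contDiff_infty_iff_deriv.1 h.smooth).2
  compact := h.compact.deriv
  supp := (closure_minimal (support_deriv_subset) isClosed_closure).trans h.supp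

lemma continuous_F : Continuous F := by
  unfold F; fun_prop

lemma Fint_integrable {φ : ℝ → ℂ} (h : IsTest φ) (x : ℝ) :
    IntervalIntegrable (fun y => φ y * F (x - y)) volume 0 1 :=
  (h.smooth.continuous.mul (continuous_F.comp (by fun_prop))).intervalIntegrable _ _

lemma IsTest.add {φ ψ : ℝ → ℂ} (h : IsTest φ) (k : IsTest ψ) : IsTest (φ + ψ) where
  smooth := h.smooth.add k.smooth
  compact := h.compact.add k.compact
  supp := (tsupport_add φ ψ).trans (Set.union_subset h.supp k.supp)

lemma IsTest.smul {φ : ℝ → ℂ} (c : ℂ) (h : IsTest φ) : IsTest (c • φ) where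
  smooth := contDiff_const.smul h.smooth
  compact := h.compact.smul_left (f := fun _ => c)
  supp := (tsupport_smul_subset_right (fun _ => c) φ).trans h.supp

lemma IsTest.zero : IsTest 0 where
  smooth := contDiff_const
  compact := HasCompactSupport.zero
  supp := by simp [tsupport]

lemma Fint_add {φ ψ : ℝ → ℂ} (h : IsTest φ) (k : IsTest ψ) (x : ℝ) :
    Fint (φ + ψ) x = Fint φ x + Fint ψ x := by
  simp only [Fint, Pi.add_apply, add_mul]
  exact intervalIntegral.integral_add (Fint_integrable h x) (Fint_integrable k x)

lemma Fint_smul (c : ℂ) (φ : ℝ → ℂ) (x : ℝ) : Fint (c • φ) x = c * Fint φ x := by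
  simp only [Fint, Pi.smul_apply, smul_eq_mul, mul_assoc, intervalIntegral.integral_const_mul]

lemma IsTest.differentiable {φ : ℝ → ℂ} (h : IsTest φ) : Differentiable ℝ φ :=
  h.smooth.differentiable (by simp)

/-- The graph `{(F_φ, F_{φ'}) : φ ∈ C_c^∞(0,1)}` in `H_F × H_F`. -/
def graphDF : Submodule ℂ (HF × HF) where
  carrier := {p | ∃ φ : ℝ → ℂ, IsTest φ ∧ (∀ x : Ω, p.1 x = Fint φ x) ∧
    ∀ x : Ω, p.2 x = Fint (deriv φ) x}
  zero_mem' := ⟨0, IsTest.zero, fun x => by simp [Fint], fun x => by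
    simp [Fint]⟩
  add_mem' := by
    rintro p q ⟨φ, h, h1, h2⟩ ⟨ψ, k, k1, k2⟩
    refine ⟨φ + ψ, h.add k, fun x => ?_, fun x => ?_⟩
    · simp [h1, k1, Fint_add h k]
    · have : deriv (φ + ψ) = deriv φ + deriv ψ := by
        ext y; exact deriv_add (h.differentiable y) (k.differentiable y)
      simp [h2, k2, this, Fint_add h.deriv k.deriv]
  smul_mem' := by
    rintro c p ⟨φ, h, h1, h2⟩
    refine ⟨c • φ, h.smul c, fun x => ?_, fun x => ?_⟩
    · simp [h1, Fint_smul]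
    · have : deriv (c • φ) = c • deriv φ := by
        ext y; exact deriv_const_smul c (h.differentiable y)
      simp [h2, this, Fint_smul]

lemma Fint_eq {φ : ℝ → ℂ} (h : IsTest φ) (x : ℝ) : Fint φ x = ∫ y, φ y * F (x - y) := by
  rw [Fint, intervalIntegral.integral_of_le zero_le_one]
  refine setIntegral_eq_integral_of_forall_compl_eq_zero fun y hy => ?_
  have : y ∉ tsupport φ := fun hy' => hy ⟨(h.supp hy').1, (h.supp hy').2.le⟩
  simp [image_eq_zero_of_notMem_tsupport this]

lemma hasDerivAt_Fint {φ : ℝ → ℂ} (h : IsTest φ) (x : ℝ) :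
    HasDerivAt (Fint φ) (Fint (deriv φ) x) x := by
  have := h.compact.hasDerivAt_convolution_left (ContinuousLinearMap.mul ℝ ℂ)
    (μ := volume) (h.smooth.of_le (by simp)) continuous_F.locallyIntegrable x
  rw [Fint_eq h.deriv]
  have e : Fint φ = fun x => ∫ y, φ y * F (x - y) := funext (Fint_eq h)
  rw [e]
  exact this

/-- Extension by zero of an element of `H_F` to a function on `ℝ`. -/
def ext0 (f : HF) (t : ℝ) : ℂ := if h : t ∈ Ω then f ⟨t, h⟩ else 0

lemma ext0_apply (f : HF) (x : Ω) : ext0 f x = f x := dif_pos x.2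

lemma hasDerivAt_ext0 {f : HF} {g : ℝ → ℂ} {g' : ℂ} {x : Ω} (hf : ∀ y : Ω, f y = g y)
    (hg : HasDerivAt g g' x) : HasDerivAt (ext0 f) g' x := by
  refine hg.congr_of_eventuallyEq ?_
  filter_upwards [isOpen_Ioo.mem_nhds x.2] with y hy
  exact (ext0_apply f ⟨y, hy⟩).trans (hf _)

lemma graphDF_deriv {p : HF × HF} (hp : p ∈ graphDF) (x : Ω) :
    HasDerivAt (ext0 p.1) (p.2 x) x := by
  obtain ⟨φ, h, h1, h2⟩ := hp
  rw [h2]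
  exact hasDerivAt_ext0 h1 (hasDerivAt_Fint h x)

lemma eq_zero_of_deriv {f : HF} (hf : f = 0) {x : Ω} {g' : ℂ} (h : HasDerivAt (ext0 f) g' x) :
    g' = 0 :=
  h.unique (hasDerivAt_ext0 (g := fun _ => 0) (fun y => by simp [hf]) (hasDerivAt_const _ _))

/-- The operator `D_F : F_φ ↦ F_{φ'}` in `H_F`, with domain `{F_φ : φ ∈ C_c^∞(0,1)}`. -/
def DF : HF →ₗ.[ℂ] HF := graphDF.toLinearPMap

theorem DF_graph : DF.graph = graphDF :=
  Submodule.toLinearPMap_graph_eq _ fun p hp h0 =>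
    RKHS.ext fun x => by simpa using eq_zero_of_deriv h0 (graphDF_deriv hp x)

/-- The operator `-i D_F`. -/
def minusIDF : HF →ₗ.[ℂ] HF := (-Complex.I) • DF

lemma minusIDF_deriv {p : HF × HF} (hp : p ∈ minusIDF.graph) (x : Ω) :
    HasDerivAt (ext0 p.1) (Complex.I * p.2 x) x := by
  rw [LinearPMap.mem_graph_iff] at hp
  obtain ⟨y, h1, h2⟩ := hp
  have hy : ((y : HF), DF y) ∈ graphDF := by
    rw [← DF_graph]; exact LinearPMap.mem_graph DF y
  have hd := graphDF_deriv hy x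
  have e : p.2 = (-Complex.I) • DF y := h2.symm
  rw [← h1, e]
  simpa [← mul_assoc] using hd

lemma norm_kerFun (x : Ω) : ‖RKHS.kerFun HF x‖ ≤ 1 := by
  rw [RKHS.norm_kerFun_eq_sqrt_norm_kernel, RKHS.OfKernel.kernel_ofKernel]
  simp [K, F]

lemma closure_deriv {p : HF × HF} (hp : p ∈ minusIDF.graph.topologicalClosure) (x : Ω) :
    HasDerivAt (ext0 p.1) (Complex.I * p.2 x) x := by
  obtain ⟨u, hu, hlim⟩ := mem_closure_iff_seq_limit.1 hp
  have h1 : Tendsto (fun n => (u n).1) atTop (𝓝 p.1) := (continuous_fst.tendsto _).comp hlim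
  have h2 : Tendsto (fun n => (u n).2) atTop (𝓝 p.2) := (continuous_snd.tendsto _).comp hlim
  have hu2 := RKHS.tendstoUniformly_of_norm_kerFun_le (C := 1) norm_kerFun
    (h2.const_smul Complex.I)
  have := hasDerivAt_of_tendstoUniformlyOn (l := atTop) (s := Ω) (𝕜 := ℝ) (x := x.1)
    (f := fun n => ext0 (u n).1) (g := ext0 p.1) (f' := fun n => ext0 (Complex.I • (u n).2))
    (g' := ext0 (Complex.I • p.2)) isOpen_Ioo ?_ ?_ ?_ x.2
  · simpa [ext0_apply] using this
  · rw [Metric.tendstoUniformlyOn_iff]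
    rw [Metric.tendstoUniformly_iff] at hu2
    intro ε hε
    filter_upwards [hu2 ε hε] with n hn y hy
    simpa only [ext0, dif_pos hy] using hn ⟨y, hy⟩
  · refine Eventually.of_forall fun n y hy => ?_
    have := minusIDF_deriv (hu n) ⟨y, hy⟩
    have e : ext0 (Complex.I • (u n).2) y = Complex.I * (u n).2 ⟨y, hy⟩ := by
      rw [ext0, dif_pos hy, RKHS.coe_smul, Pi.smul_apply, smul_eq_mul]
    rw [e]
    exact this
  · intro y hy
    simp only [ext0, dif_pos hy]
    exact ((RKHS.continuous_eval (H := HF) (⟨y, hy⟩ : Ω)).tendsto _).comp h1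

/-- The function `e^{-x} + s e^{iθ} e^{x-1}`. -/
def defect (θ s : ℝ) (x : ℝ) : ℂ :=
  Complex.exp (-x) + s * (Complex.exp (θ * Complex.I) * Complex.exp (x - 1))

/-- The graph of `A_θ`: all pairs
`(h + c (e^{-x} + e^{iθ} e^{x-1}), k + i c (e^{-x} - e^{iθ} e^{x-1}))` with `c ∈ ℂ` and
`(h, k)` in the closure of the graph of `-i D_F`. -/
def graphA (θ : ℝ) : Submodule ℂ (HF × HF) where
  carrier := {p | ∃ q ∈ minusIDF.graph.topologicalClosure, ∃ c : ℂ,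
    (∀ x : Ω, p.1 x = q.1 x + c * defect θ 1 x) ∧
    ∀ x : Ω, p.2 x = q.2 x + Complex.I * c * defect θ (-1) x}
  zero_mem' := ⟨0, zero_mem _, 0, fun x => by simp, fun x => by simp⟩
  add_mem' := by
    rintro p p' ⟨q, hq, c, h1, h2⟩ ⟨q', hq', c', h1', h2'⟩
    refine ⟨q + q', add_mem hq hq', c + c', fun x => ?_, fun x => ?_⟩
    · simp [h1, h1']; ring
    · simp [h2, h2']; ring
  smul_mem' := by
    rintro a p ⟨q, hq, c, h1, h2⟩
    refine ⟨a • q, Submodule.smul_mem _ a hq, a * c, fun x => ?_, fun x => ?_⟩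
    · simp [h1]; ring
    · simp [h2]; ring

lemma hasDerivAt_defect (θ : ℝ) (x : ℝ) :
    HasDerivAt (defect θ 1) (-defect θ (-1) x) x := by
  have h1 : HasDerivAt (fun t : ℝ => Complex.exp (-(t : ℂ))) (-Complex.exp (-x)) x := by
    simpa using (Complex.ofRealCLM.hasDerivAt (x := x)).neg.cexp
  have h2 : HasDerivAt (fun t : ℝ => Complex.exp ((t : ℂ) - 1)) (Complex.exp (x - 1)) x := by
    simpa using ((Complex.ofRealCLM.hasDerivAt (x := x)).sub_const 1).cexp
  have := h1.add ((h2.const_mul (Complex.exp (θ * Complex.I))).const_mul ((1 : ℝ) : ℂ))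
  refine this.congr_deriv ?_
  simp [defect, add_comm]

/-- The extension `A_θ` of `-i D_F`. -/
def A (θ : ℝ) : HF →ₗ.[ℂ] HF := (graphA θ).toLinearPMap

theorem A_graph (θ : ℝ) : (A θ).graph = graphA θ := by
  refine Submodule.toLinearPMap_graph_eq _ ?_
  rintro p ⟨q, hq, c, h1, h2⟩ h0
  refine RKHS.ext fun x => ?_
  have hd := closure_deriv hq x
  have hd' : HasDerivAt (ext0 q.1) (c * defect θ (-1) x) x := by
    refine (hasDerivAt_ext0 (g := fun t => -c * defect θ 1 t) (fun y => ?_)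
      ((hasDerivAt_defect θ x).const_mul (-c))).congr_deriv (by ring)
    have := h1 y
    rw [h0] at this
    simp only [RKHS.coe_zero, Pi.zero_apply] at this
    linear_combination -this
  have e := hd.unique hd'
  rw [h2 x, mul_assoc, ← e, ← mul_assoc, Complex.I_mul_I]
  simp

/-- The resolvent set of a (possibly unbounded) operator `T`: the `z ∈ ℂ` for which
`T - z : dom T → H` has an everywhere defined bounded inverse `R`. -/
def resolventSet {H : Type*} [NormedAddCommGroup H] [InnerProductSpace ℂ H]
    (T : H →ₗ.[ℂ] H) : Set ℂ :=
  {z | ∃ R : H →L[ℂ] H, (∀ x : T.domain, R (T x - z • (x : H)) = x) ∧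
    ∀ y : H, ∃ x : T.domain, (x : H) = R y ∧ T x - z • (x : H) = y}

/-- The spectrum of a (possibly unbounded) operator. -/
def spec {H : Type*} [NormedAddCommGroup H] [InnerProductSpace ℂ H]
    (T : H →ₗ.[ℂ] H) : Set ℂ :=
  (resolventSet T)ᶜ

/-- The spectrum of `A_θ` in `ℝ`. -/
def Λ (θ : ℝ) : Set ℝ := {l | (l : ℂ) ∈ spec (A θ)}

/-- The exponential `e_λ(x) = e^{iλx}`. -/
def expFun (l x : ℝ) : ℂ := Complex.exp (Complex.I * l * x)

end ExpKernel

end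

noncomputable section

namespace ExpKernel

open Set Filter Topology MeasureTheory ComplexConjugate
open scoped ContDiff InnerProductSpace

/-! ### Kernel functions up to the boundary -/

/-! The argument is von Neumann's extension theory with deficiency indices (1,1), made concrete by
boundary values. Since ‖K_x - K_y‖² ≤ 2|x - y|, kernel functions extend to the endpoints (`kap`), so
every element of the space has values at 0 and 1, and e^{-x}, e^{x-1} are the unit vectors `kap 0`,
`kap 1`. Pairing with F_φ is integration against the conjugate of φ; by du Bois-Reymond the adjoint
of -iD_F is therefore the full relation f' = ik (`mem_adjoint_graph_minusIDF`). Its eigenvectors for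
±i are exactly the multiples of e^{-x} and e^{x-1}, and projecting onto the closed graph gives the
decomposition `exists_decomposition`. Two continuous functionals `bα`, `bβ` read off the
coefficients, and the boundary form is a multiple of ᾱα' - β̄β' (`bform_eq`). Its maximal isotropic
subspaces are the lines β = e^{iθ}α, which are the A_θ (`graphA_adjoint`, `exists_eq_A`).

The real eigenvalues of A_θ solve (1 + iλ)e^{iλ} = e^{iθ}(1 - iλ), with eigenvector e_λ; symmetry
makes distinct ones orthogonal. For completeness, (1 + A²)⁻¹ is half of the compact operator g ↦ F_g
plus an operator of rank at most two (`eq_Kop_add`), so the spectral theorem for compact symmetric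
operators applies, and its eigenvectors split into eigenvectors of A (`span_expHF_orthogonal`). The
eigenbasis bounds A - z from below off the eigenvalues, so the spectrum is the set of eigenvalues
(`spec_A`).

Solutions of λ + 2 arctan λ = θ + 2πn are eigenvalues. Consecutive gaps along them are strictly
below 2π but tend to 2π (`exists_eigs_seq`). Gaps lying in dℤ could not do this, and a gap in (0,
2π) gives a nonzero L² inner product. -/

/-- The kernel function of `HF` at the point `x ∈ (0,1)`. -/
def ker (x : Ω) : HF := RKHS.kerFun HF x 1

lemma inner_ker (x : Ω) (f : HF) : ⟪ker x, f⟫_ℂ = f x := by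
  simp [ker]

lemma ker_apply (x y : Ω) : ker y x = F (x.1 - y.1) := by
  rw [ker, RKHS.kerFun_apply, RKHS.OfKernel.kernel_ofKernel, K_apply, mul_one]

lemma inner_ker_ker (x y : Ω) : ⟪ker x, ker y⟫_ℂ = F (x.1 - y.1) := by
  rw [inner_ker, ker_apply]

lemma F_zero : F 0 = 1 := by simp [F]

lemma F_neg (x : ℝ) : F (-x) = F x := by simp [F]

lemma conj_F (x : ℝ) : conj (F x) = F x := Complex.conj_ofReal _

/-- The square is 2 - 2e^{-|x-y|}. The resulting Hölder bound is what lets kernel functions extend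
to the endpoints. -/
lemma norm_ker_sub_sq_le (x y : Ω) : ‖ker x - ker y‖ ^ 2 ≤ 2 * |x.1 - y.1| := by
  have h := norm_sub_sq (𝕜 := ℂ) (ker x) (ker y)
  have hn : ∀ z : Ω, ‖ker z‖ ^ 2 = 1 := fun z => by
    have := inner_self_eq_norm_sq (𝕜 := ℂ) (ker z)
    rw [inner_ker_ker, sub_self, F_zero] at this
    simpa using this.symm
  rw [hn, hn, inner_ker_ker] at h
  have hF : RCLike.re (F (x.1 - y.1)) = Real.exp (-|x.1 - y.1|) := by
    exact Complex.ofReal_re _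
  rw [hF] at h
  have := Real.add_one_le_exp (-|x.1 - y.1|)
  linarith

/-- The kernel functions as a function on the line, zero outside `(0,1)`. -/
def kerExt (t : ℝ) : HF := if h : t ∈ Ω then ker ⟨t, h⟩ else 0

lemma closure_Ω : closure Ω = Icc (0 : ℝ) 1 := closure_Ioo zero_ne_one

lemma exists_tendsto_kerExt {x : ℝ} (hx : x ∈ Icc (0 : ℝ) 1) :
    ∃ y, Tendsto kerExt (𝓝[Ω] x) (𝓝 y) := by
  have : (𝓝[Ω] x).NeBot := mem_closure_iff_nhdsWithin_neBot.1 (closure_Ω ▸ hx)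
  have hc : Cauchy (map kerExt (𝓝[Ω] x)) := by
    rw [Metric.cauchy_iff]
    refine ⟨inferInstance, fun ε hε => ?_⟩
    -- Two points of this ball are less than ε²/2 apart, so by the Hölder bound their kernel
    -- functions are at distance less than ε.
    refine ⟨kerExt '' (Metric.ball x (ε ^ 2 / 4) ∩ Ω), image_mem_map
      (inter_mem (mem_nhdsWithin_of_mem_nhds (Metric.ball_mem_nhds _ (by positivity)))
        self_mem_nhdsWithin), ?_⟩
    rintro _ ⟨s, ⟨hs, hs'⟩, rfl⟩ _ ⟨t, ⟨ht, ht'⟩, rfl⟩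
    rw [kerExt, kerExt, dif_pos hs', dif_pos ht', dist_eq_norm]
    have h1 := norm_ker_sub_sq_le ⟨s, hs'⟩ ⟨t, ht'⟩
    have h2 : |s - t| < ε ^ 2 / 2 := by
      have := dist_triangle_right s t x
      rw [Metric.mem_ball] at hs ht
      rw [← Real.dist_eq]
      linarith
    exact lt_of_pow_lt_pow_left₀ 2 hε.le (by simp only at h1; linarith)
  exact cauchy_iff_exists_le_nhds.1 hc

/-- The kernel functions, extended continuously to the endpoints of `(0,1)` and constantly
beyond them. -/
def kap (t : ℝ) : HF := extendFrom Ω kerExt (projIcc (0 : ℝ) 1 zero_le_one t)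

lemma continuous_kap : Continuous kap := by
  have h : ContinuousOn (extendFrom Ω kerExt) (Icc 0 1) :=
    continuousOn_extendFrom closure_Ω.ge fun x hx => exists_tendsto_kerExt hx
  exact h.comp_continuous (continuous_subtype_val.comp continuous_projIcc) fun t => Subtype.prop _

lemma kap_eq (x : Ω) : kap x = ker x := by
  have hc : ContinuousOn kerExt Ω := by
    intro t ht
    obtain ⟨y, hy⟩ := exists_tendsto_kerExt (Ioo_subset_Icc_self ht)
    rw [isOpen_Ioo.nhdsWithin_eq ht] at hy
    exact (continuousAt_of_tendsto_nhds hy).continuousWithinAt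
  have h := extendFrom_extends hc x x.2
  rw [kap, projIcc_of_mem zero_le_one (Ioo_subset_Icc_self x.2), h, kerExt, dif_pos x.2]

/-- The continuous extension of `f ∈ HF` to the line, constant outside `(0,1)`. -/
def val (f : HF) (t : ℝ) : ℂ := ⟪kap t, f⟫_ℂ

lemma val_eq (f : HF) (x : Ω) : val f x = f x := by
  rw [val, kap_eq, inner_ker]

lemma continuous_val (f : HF) : Continuous (val f) :=
  continuous_kap.inner continuous_const

/-- Both sides are continuous in each variable, so the identity passes from (0,1) to the closure,
one variable at a time. -/
lemma inner_kap_kap {s t : ℝ} (hs : s ∈ Icc (0 : ℝ) 1) (ht : t ∈ Icc (0 : ℝ) 1) :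
    ⟪kap s, kap t⟫_ℂ = F (s - t) := by
  have h1 : ∀ x : Ω, ⟪kap x, kap t⟫_ℂ = F (x.1 - t) := fun x => by
    have hcl : IsClosed {u : ℝ | ⟪kap x, kap u⟫_ℂ = F (x.1 - u)} :=
      isClosed_eq (continuous_const.inner continuous_kap)
        (continuous_F.comp (continuous_const.sub continuous_id))
    have hsub : Ω ⊆ {u : ℝ | ⟪kap x, kap u⟫_ℂ = F (x.1 - u)} := fun u hu => by
      rw [mem_ofPred_eq, kap_eq, kap_eq ⟨u, hu⟩, inner_ker_ker]
    exact closure_minimal hsub hcl (closure_Ω ▸ ht)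
  have hcl : IsClosed {u : ℝ | ⟪kap u, kap t⟫_ℂ = F (u - t)} :=
    isClosed_eq (continuous_kap.inner continuous_const)
      (continuous_F.comp (continuous_id.sub continuous_const))
  exact closure_minimal (fun u hu => h1 ⟨u, hu⟩) hcl (closure_Ω ▸ hs)

lemma val_kap {s t : ℝ} (hs : s ∈ Icc (0 : ℝ) 1) (ht : t ∈ Icc (0 : ℝ) 1) :
    val (kap s) t = F (t - s) := inner_kap_kap ht hs

/-! ### Superpositions of kernel functions -/

/-- The element `∫_0^1 h(t) F(· - t) dt` of `HF`. -/
def J (h : ℝ → ℂ) : HF := ∫ t in (0 : ℝ)..1, h t • kap t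

lemma inner_J_right {h : ℝ → ℂ} (hh : Continuous h) (g : HF) :
    ⟪g, J h⟫_ℂ = ∫ t in (0 : ℝ)..1, h t * conj (val g t) := by
  have := (innerSL ℂ g).intervalIntegral_comp_comm (μ := volume) (a := 0) (b := 1)
    ((hh.smul continuous_kap).intervalIntegrable 0 1)
  rw [J]
  refine this.symm.trans ?_
  refine intervalIntegral.integral_congr fun t _ => ?_
  simp only [innerSL_apply_apply, Pi.smul_apply', inner_smul_right, val, inner_conj_symm]

lemma inner_J_left {h : ℝ → ℂ} (hh : Continuous h) (g : HF) :
    ⟪J h, g⟫_ℂ = ∫ t in (0 : ℝ)..1, conj (h t) * val g t := by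
  rw [← inner_conj_symm, inner_J_right hh, ← intervalIntegral.intervalIntegral_conj]
  simp

lemma val_J {h : ℝ → ℂ} (hh : Continuous h) {x : ℝ} (hx : x ∈ Icc (0 : ℝ) 1) :
    val (J h) x = Fint h x := by
  rw [val, inner_J_right hh, Fint]
  refine intervalIntegral.integral_congr fun t ht => ?_
  rw [uIcc_of_le zero_le_one] at ht
  simp only [val_kap hx ht, conj_F]
  rw [← F_neg, neg_sub]

lemma J_apply {h : ℝ → ℂ} (hh : Continuous h) (x : Ω) : J h x = Fint h x := by
  rw [← val_eq, val_J hh (Ioo_subset_Icc_self x.2)]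

/-! ### Weak derivatives on `(0,1)` -/

lemma IsTest.exists_subset_Icc {φ : ℝ → ℂ} (h : IsTest φ) :
    ∃ a b : ℝ, 0 < a ∧ b < 1 ∧ ∀ x, x < a ∨ b < x → φ x = 0 := by
  rcases (tsupport φ).eq_empty_or_nonempty with he | hne
  -- With empty support any bounds do; a ≤ b is not required.
  · refine ⟨1, 0, one_pos, one_pos, fun x _ => ?_⟩
    exact image_eq_zero_of_notMem_tsupport (by simp [he])
  · obtain ⟨a, ha, ha'⟩ := h.compact.isCompact.exists_isLeast hne
    obtain ⟨b, hb, hb'⟩ := h.compact.isCompact.exists_isGreatest hne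
    refine ⟨a, b, (h.supp ha).1, (h.supp hb).2, fun x hx => ?_⟩
    refine image_eq_zero_of_notMem_tsupport fun hx' => ?_
    rcases hx with hx | hx
    · exact absurd (ha' hx') (not_le.2 hx)
    · exact absurd (hb' hx') (not_le.2 hx)

lemma IsTest.integral_mul_eq {φ : ℝ → ℂ} (h : IsTest φ) (u : ℝ → ℂ) :
    ∫ x in (0 : ℝ)..1, φ x * u x = ∫ x, φ x * u x := by
  rw [intervalIntegral.integral_of_le zero_le_one]
  refine setIntegral_eq_integral_of_forall_compl_eq_zero fun y hy => ?_
  have : y ∉ tsupport φ := fun hy' => hy ⟨(h.supp hy').1, (h.supp hy').2.le⟩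
  simp [image_eq_zero_of_notMem_tsupport this]

lemma IsTest.sub {φ ψ : ℝ → ℂ} (h : IsTest φ) (k : IsTest ψ) : IsTest (φ - ψ) := by
  have := h.add (k.smul (-1))
  rwa [neg_one_smul, ← sub_eq_add_neg] at this

lemma IsTest.conj {φ : ℝ → ℂ} (h : IsTest φ) : IsTest (fun x => conj (φ x)) where
  smooth := Complex.conjCLE.contDiff.comp h.smooth
  compact := h.compact.comp_left (g := fun z : ℂ => (starRingEnd ℂ) z) (map_zero _)
  supp := (tsupport_comp_subset (g := fun z : ℂ => (starRingEnd ℂ) z) (map_zero _) φ).trans h.supp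

lemma IsTest.deriv_conj {φ : ℝ → ℂ} (h : IsTest φ) (x : ℝ) :
    _root_.deriv (fun x => (starRingEnd ℂ) (φ x)) x = (starRingEnd ℂ) (_root_.deriv φ x) :=
  ((Complex.conjCLE.toContinuousLinearMap.hasFDerivAt).comp_hasDerivAt x
    (h.differentiable x).hasDerivAt).deriv

/-- The primitive of a test function of mean zero is a test function. -/
lemma IsTest.exists_primitive {φ : ℝ → ℂ} (h : IsTest φ) (h0 : ∫ x in (0 : ℝ)..1, φ x = 0) :
    ∃ ψ, IsTest ψ ∧ _root_.deriv ψ = φ := by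
  have hc := h.smooth.continuous
  have hd : ∀ x, HasDerivAt (fun x => ∫ t in (0 : ℝ)..x, φ t) (φ x) x := fun x =>
    hc.integral_hasStrictDerivAt 0 x |>.hasDerivAt
  have hd' : _root_.deriv (fun x => ∫ t in (0 : ℝ)..x, φ t) = φ := funext fun x => (hd x).deriv
  obtain ⟨a, b, ha, hb, hab⟩ := h.exists_subset_Icc
  have hz : ∀ x, x < a ∨ b < x → ∫ t in (0 : ℝ)..x, φ t = 0 := by
    rintro x (hx | hx)
    · refine intervalIntegral.integral_zero_ae (Eventually.of_forall fun t ht => hab t (Or.inl ?_))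
      rw [uIoc, mem_Ioc] at ht
      exact ht.2.trans_lt (max_lt ha hx)
    -- Beyond the support the primitive equals the full integral, which is zero by the mean-zero
    -- hypothesis.
    · rw [← intervalIntegral.integral_add_adjacent_intervals (b := 1)
        (hc.intervalIntegrable _ _) (hc.intervalIntegrable _ _), h0, zero_add]
      refine intervalIntegral.integral_zero_ae (Eventually.of_forall fun t ht => hab t (Or.inr ?_))
      rw [uIoc, mem_Ioc] at ht
      exact (lt_min hb hx).trans ht.1
  have hs : tsupport (fun x => ∫ t in (0 : ℝ)..x, φ t) ⊆ Icc a b := by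
    refine closure_minimal (fun x hx => ?_) isClosed_Icc
    by_contra hx'
    rw [mem_Icc, not_and_or, not_le, not_le] at hx'
    exact hx (hz x hx')
  refine ⟨_, ⟨?_, ?_, ?_⟩, hd'⟩
  · rw [contDiff_infty_iff_deriv, hd']
    exact ⟨fun x => (hd x).differentiableAt, h.smooth⟩
  · exact isCompact_Icc.of_isClosed_subset (isClosed_tsupport _) hs
  · exact hs.trans fun x hx => ⟨ha.trans_le hx.1, hx.2.trans_lt hb⟩

lemma isTest_ofReal {g : ℝ → ℝ} (h1 : ContDiff ℝ ∞ g) (h2 : HasCompactSupport g)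
    (h3 : tsupport g ⊆ Ω) : IsTest (fun x => (g x : ℂ)) where
  smooth := Complex.ofRealCLM.contDiff.comp h1
  compact := h2.comp_left (g := fun x : ℝ => (x : ℂ)) Complex.ofReal_zero
  supp := (tsupport_comp_subset (g := fun x : ℝ => (x : ℂ)) Complex.ofReal_zero g).trans h3

lemma exists_isTest_integral_one : ∃ η, IsTest η ∧ ∫ x in (0 : ℝ)..1, η x = 1 := by
  let b : ContDiffBump (1 / 2 : ℝ) := ⟨1 / 8, 1 / 4, by norm_num, by norm_num⟩
  have hb : IsTest (fun x => (b.normed volume x : ℂ)) := by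
    refine isTest_ofReal b.contDiff_normed b.hasCompactSupport_normed ?_
    rw [b.tsupport_normed_eq, Real.closedBall_eq_Icc]
    intro x hx
    have h1 : b.rOut = 1 / 4 := rfl
    rw [h1, mem_Icc] at hx
    constructor <;> linarith [hx.1, hx.2]
  refine ⟨_, hb, ?_⟩
  have := hb.integral_mul_eq (fun _ => 1)
  simp only [mul_one] at this
  rw [this, integral_complex_ofReal, b.integral_normed, Complex.ofReal_one]

/-- A continuous function orthogonal to all test functions vanishes on `(0,1)`. -/
lemma eq_zero_of_forall_integral {v : ℝ → ℂ} (hv : Continuous v)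
    (h : ∀ φ, IsTest φ → ∫ x in (0 : ℝ)..1, φ x * v x = 0) {x : ℝ} (hx : x ∈ Ω) : v x = 0 := by
  have hae : ∀ᵐ y ∂(volume : Measure ℝ), y ∈ Ω → v y = 0 := by
    refine isOpen_Ioo.ae_eq_zero_of_integral_contDiff_smul_eq_zero
      (hv.locallyIntegrable.locallyIntegrableOn _) fun g h1 h2 h3 => ?_
    have ht := isTest_ofReal h1 h2 h3
    have := h _ ht
    rw [ht.integral_mul_eq] at this
    simpa only [Complex.real_smul] using this
  have hae' : v =ᵐ[volume.restrict Ω] fun _ => 0 :=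
    (ae_restrict_iff' measurableSet_Ioo).2 hae
  exact Measure.eqOn_open_of_ae_eq hae' isOpen_Ioo hv.continuousOn continuousOn_const hx

/-- **du Bois-Reymond lemma**: a continuous function orthogonal to the derivatives of all test
functions is constant on `(0,1)`. -/
lemma exists_const_of_forall_integral_deriv {v : ℝ → ℂ} (hv : Continuous v)
    (h : ∀ φ, IsTest φ → ∫ x in (0 : ℝ)..1, deriv φ x * v x = 0) :
    ∃ c, ∀ x ∈ Ω, v x = c := by
  obtain ⟨η, hη, hη1⟩ := exists_isTest_integral_one
  refine ⟨∫ x in (0 : ℝ)..1, η x * v x, fun x hx => ?_⟩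
  refine sub_eq_zero.1 (eq_zero_of_forall_integral (hv.sub continuous_const) (fun φ hφ => ?_) hx)
  have hi : ∀ {f : ℝ → ℂ}, Continuous f → IntervalIntegrable f volume 0 1 := fun hf =>
    hf.intervalIntegrable _ _
  have hφc := hφ.smooth.continuous
  have hηc := hη.smooth.continuous
  -- Subtracting (∫φ)η makes the mean zero, so the difference is the derivative of a test function.
  obtain ⟨ψ, hψ, hψ'⟩ := (hφ.sub (hη.smul (∫ x in (0 : ℝ)..1, φ x))).exists_primitive (by
    simp only [Pi.sub_apply, Pi.smul_apply, smul_eq_mul]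
    rw [intervalIntegral.integral_sub (hi hφc) (hi (by fun_prop)),
      intervalIntegral.integral_const_mul, hη1, mul_one, sub_self])
  have h1 := h ψ hψ
  rw [hψ'] at h1
  simp only [Pi.sub_apply, Pi.smul_apply, smul_eq_mul, sub_mul, mul_assoc] at h1
  rw [intervalIntegral.integral_sub (hi (by fun_prop)) (hi (by fun_prop)),
    intervalIntegral.integral_const_mul] at h1
  simp only [Pi.sub_apply, mul_sub]
  rw [intervalIntegral.integral_sub (hi (by fun_prop)) (hi (by fun_prop)),
    intervalIntegral.integral_mul_const]
  exact h1

/-- Integration by parts against a test function. -/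
lemma IsTest.integral_deriv_mul {φ u w : ℝ → ℂ} (h : IsTest φ) (hu : Continuous u)
    (hw : Continuous w) (hd : ∀ x ∈ Ω, HasDerivAt u (w x) x) :
    ∫ x in (0 : ℝ)..1, _root_.deriv φ x * u x = -∫ x in (0 : ℝ)..1, φ x * w x := by
  have h0 : φ 0 = 0 := image_eq_zero_of_notMem_tsupport fun h' => lt_irrefl _ (h.supp h').1
  have h1 : φ 1 = 0 := image_eq_zero_of_notMem_tsupport fun h' => lt_irrefl _ (h.supp h').2
  have := intervalIntegral.integral_deriv_mul_eq_sub_of_hasDeriv_right (a := (0 : ℝ)) (b := 1)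
    (u := φ) (v := u) (u' := _root_.deriv φ) (v' := w)
    h.smooth.continuous.continuousOn hu.continuousOn
    (fun x _ => (h.differentiable x).hasDerivAt.hasDerivWithinAt)
    (fun x hx => (hd x (by simpa using hx)).hasDerivWithinAt)
    (h.deriv.smooth.continuous.intervalIntegrable _ _) (hw.intervalIntegrable _ _)
  have hc := h.smooth.continuous
  have hc' := h.deriv.smooth.continuous
  rw [intervalIntegral.integral_add (f := fun x => _root_.deriv φ x * u x)
    (g := fun x => φ x * w x) ((hc'.mul hu).intervalIntegrable _ _)
    ((hc.mul hw).intervalIntegrable _ _), h0, h1] at this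
  simp only [zero_mul, sub_self] at this
  exact eq_neg_of_add_eq_zero_left this

/-- A continuous weak derivative of a continuous function is a derivative. -/
lemma hasDerivAt_of_weak {u w : ℝ → ℂ} (hu : Continuous u) (hw : Continuous w)
    (h : ∀ φ, IsTest φ →
      ∫ x in (0 : ℝ)..1, deriv φ x * u x = -∫ x in (0 : ℝ)..1, φ x * w x)
    {x : ℝ} (hx : x ∈ Ω) : HasDerivAt u (w x) x := by
  have hd : ∀ x, HasDerivAt (fun x => ∫ t in (0 : ℝ)..x, w t) (w x) x := fun x =>
    (hw.integral_hasStrictDerivAt 0 x).hasDerivAt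
  have hW : Continuous (fun x => ∫ t in (0 : ℝ)..x, w t) :=
    continuous_iff_continuousAt.2 fun x => (hd x).continuousAt
  -- The difference of u and a primitive of w has weak derivative zero, hence is constant.
  obtain ⟨c, hc⟩ := exists_const_of_forall_integral_deriv (hu.sub hW) fun φ hφ => by
    have h1 := h φ hφ
    rw [← hφ.integral_deriv_mul hW hw fun x _ => hd x] at h1
    have hc' := hφ.deriv.smooth.continuous
    simp only [Pi.sub_apply, mul_sub]
    rw [intervalIntegral.integral_sub (f := fun x => deriv φ x * u x)
      (g := fun x => deriv φ x * ∫ t in (0 : ℝ)..x, w t) ((hc'.mul hu).intervalIntegrable _ _)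
      ((hc'.mul hW).intervalIntegrable _ _), h1, sub_self]
  refine ((hd x).const_add c).congr_of_eventuallyEq ?_
  filter_upwards [isOpen_Ioo.mem_nhds hx] with y hy
  rw [← hc y hy, Pi.sub_apply, sub_add_cancel]

/-! ### Orthogonal projection onto a closed graph -/

/-- The product carries the sup norm, so the orthogonal projection is taken in the ℓ² product and
transported back. A vector (u, v) is orthogonal to S exactly when (v, -u) lies in the adjoint
relation. This serves twice: for von Neumann's decomposition and for (1 + A²)⁻¹. -/
lemma exists_graph_projection {H : Type*} [NormedAddCommGroup H] [InnerProductSpace ℂ H]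
    [CompleteSpace H] (S : Submodule ℂ (H × H)) (hS : IsClosed (S : Set (H × H))) :
    ∃ P : H × H →L[ℂ] H × H, (∀ p, P p ∈ S) ∧
      ∀ p, ((p - P p).2, -(p - P p).1) ∈ S.adjoint := by
  let e := WithLp.prodContinuousLinearEquiv 2 ℂ H H
  let S' : Submodule ℂ (WithLp 2 (H × H)) := S.comap e.toLinearEquiv.toLinearMap
  have hS' : IsClosed (S' : Set (WithLp 2 (H × H))) := hS.preimage e.continuous
  have : CompleteSpace S' := hS'.completeSpace_coe
  refine ⟨e.toContinuousLinearMap ∘L S'.starProjection ∘L e.symm.toContinuousLinearMap,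
    fun p => S'.starProjection_apply_mem (e.symm p), fun p => ?_⟩
  rw [Submodule.mem_adjoint_iff]
  intro a b hab
  have h := S'.inner_right_of_mem_orthogonal (u := e.symm (a, b)) hab
    (S'.sub_starProjection_mem_orthogonal (e.symm p))
  rw [WithLp.prod_inner_apply] at h
  rw [inner_neg_right, sub_neg_eq_add, add_comm]
  exact h

/-! ### The graph of `-i D_F` and its adjoint -/

lemma mem_graph_minusIDF {p : HF × HF} :
    p ∈ minusIDF.graph ↔
      ∃ φ, IsTest φ ∧ p.1 = J φ ∧ p.2 = (-Complex.I) • J (deriv φ) := by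
  have hDF : ∀ q : HF × HF, q ∈ graphDF ↔ ∃ φ, IsTest φ ∧ q.1 = J φ ∧ q.2 = J (deriv φ) := by
    intro q
    constructor
    · rintro ⟨φ, h, h1, h2⟩
      exact ⟨φ, h, RKHS.ext fun x => by rw [h1, J_apply h.smooth.continuous],
        RKHS.ext fun x => by rw [h2, J_apply h.deriv.smooth.continuous]⟩
    · rintro ⟨φ, h, h1, h2⟩
      exact ⟨φ, h, fun x => by rw [h1, J_apply h.smooth.continuous],
        fun x => by rw [h2, J_apply h.deriv.smooth.continuous]⟩
  rw [minusIDF, LinearPMap.smul_graph, DF_graph, Submodule.mem_map]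
  constructor
  · rintro ⟨q, hq, rfl⟩
    obtain ⟨φ, h, h1, h2⟩ := (hDF q).1 hq
    refine ⟨φ, h, ?_, ?_⟩
    · simpa using h1
    · simp [h2]
  · rintro ⟨φ, h, h1, h2⟩
    refine ⟨(J φ, J (deriv φ)), (hDF _).2 ⟨φ, h, rfl, rfl⟩, ?_⟩
    ext1
    · simp [h1]
    · simp [h2]

/-- A vector g orthogonal to all F_φ has ∫ φ g = 0 for every test function, so it vanishes. -/
lemma dense_domain_minusIDF : Dense (minusIDF.domain : Set HF) := by
  rw [Submodule.dense_iff_topologicalClosure_eq_top, Submodule.topologicalClosure_eq_top_iff,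
    Submodule.eq_bot_iff]
  intro g hg
  refine RKHS.ext fun x => ?_
  rw [← val_eq]
  rw [RKHS.coe_zero, Pi.zero_apply]
  refine eq_zero_of_forall_integral (continuous_val g) (fun φ hφ => ?_) x.2
  have hm : J (fun x => conj (φ x)) ∈ minusIDF.domain :=
    LinearPMap.mem_domain_of_mem_graph (y := (-Complex.I) • J (deriv fun x => conj (φ x)))
      (mem_graph_minusIDF.2 ⟨_, hφ.conj, rfl, rfl⟩)
  have := Submodule.inner_right_of_mem_orthogonal hm hg
  rw [inner_J_left hφ.conj.smooth.continuous] at this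
  simpa using this

/-- The adjoint relation of `-i D_F` is the maximal differentiation relation. -/
lemma mem_adjoint_graph_minusIDF {p : HF × HF} :
    p ∈ minusIDF.graph.adjoint ↔
      ∀ x ∈ Ω, HasDerivAt (val p.1) (Complex.I * val p.2 x) x := by
  have hc : Continuous fun x => Complex.I * val p.2 x := continuous_const.mul (continuous_val _)
  rw [Submodule.mem_adjoint_iff]
  have key : ∀ φ, IsTest φ → ⟪(-Complex.I) • J (deriv φ), p.1⟫_ℂ - ⟪J φ, p.2⟫_ℂ =
      Complex.I * ((∫ x in (0 : ℝ)..1, deriv (fun x => conj (φ x)) x * val p.1 x) +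
        ∫ x in (0 : ℝ)..1, conj (φ x) * (Complex.I * val p.2 x)) := by
    intro φ hφ
    rw [inner_smul_left, inner_J_left hφ.deriv.smooth.continuous,
      inner_J_left hφ.smooth.continuous]
    have e1 : ∀ x, conj (φ x) * (Complex.I * val p.2 x) =
        Complex.I * (conj (φ x) * val p.2 x) := fun x => by ring
    simp only [hφ.deriv_conj, e1, intervalIntegral.integral_const_mul, map_neg, Complex.conj_I,
      neg_neg]
    rw [mul_add, ← mul_assoc, Complex.I_mul_I]
    ring
  constructor
  · intro h x hx
    refine hasDerivAt_of_weak (continuous_val _) hc (fun φ hφ => ?_) hx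
    have h1 := h (J fun x => conj (φ x)) _ (mem_graph_minusIDF.2 ⟨_, hφ.conj, rfl, rfl⟩)
    rw [key _ hφ.conj] at h1
    simp only [Complex.conj_conj, mul_eq_zero, Complex.I_ne_zero, false_or] at h1
    exact eq_neg_of_add_eq_zero_left h1
  · rintro h a b hab
    obtain ⟨φ, hφ, rfl, rfl⟩ := mem_graph_minusIDF.1 hab
    rw [key _ hφ, hφ.conj.integral_deriv_mul (continuous_val _) hc h, neg_add_cancel, mul_zero]

lemma hasDerivAt_val_iff {f : HF} {x : ℝ} (hx : x ∈ Ω) {z : ℂ} :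
    HasDerivAt (val f) z x ↔ HasDerivAt (ext0 f) z x := by
  have : val f =ᶠ[𝓝 x] ext0 f := by
    filter_upwards [isOpen_Ioo.mem_nhds hx] with y hy
    rw [ext0, dif_pos hy, ← val_eq]
  exact this.hasDerivAt_iff

lemma closure_graph_le_adjoint :
    minusIDF.graph.topologicalClosure ≤ minusIDF.graph.adjoint := fun p hp => by
  rw [mem_adjoint_graph_minusIDF]
  intro x hx
  rw [hasDerivAt_val_iff hx, ← Subtype.coe_mk x hx, val_eq]
  exact closure_deriv hp ⟨x, hx⟩

/-! ### The deficiency spaces -/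

/-- The function `e^{-x}`. -/
def vp : HF := kap 0

/-- The function `e^{x-1}`. -/
def vm : HF := kap 1

lemma val_vp {x : ℝ} (hx : x ∈ Icc (0 : ℝ) 1) : val vp x = Complex.exp (-x) := by
  rw [vp, val_kap (left_mem_Icc.2 zero_le_one) hx, F, sub_zero, abs_of_nonneg hx.1]
  simp

lemma val_vm {x : ℝ} (hx : x ∈ Icc (0 : ℝ) 1) : val vm x = Complex.exp (x - 1) := by
  rw [vm, val_kap (right_mem_Icc.2 zero_le_one) hx, F, abs_of_nonpos (by linarith [hx.2])]
  simp

lemma val_add (f g : HF) (x : ℝ) : val (f + g) x = val f x + val g x := inner_add_right _ _ _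

lemma val_sub (f g : HF) (x : ℝ) : val (f - g) x = val f x - val g x := inner_sub_right _ _ _

lemma val_neg (f : HF) (x : ℝ) : val (-f) x = -val f x := inner_neg_right _ _

lemma val_smul (c : ℂ) (f : HF) (x : ℝ) : val (c • f) x = c * val f x := inner_smul_right _ _ _

lemma ext_val {f g : HF} (h : ∀ x ∈ Ω, val f x = val g x) : f = g :=
  RKHS.ext fun x => by rw [← val_eq, ← val_eq, h x x.2]

lemma hasDerivAt_exp_mul (a b : ℂ) (x : ℝ) :
    HasDerivAt (fun x : ℝ => Complex.exp (a * x + b)) (a * Complex.exp (a * x + b)) x := by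
  have := (((Complex.ofRealCLM.hasDerivAt (x := x)).const_mul a).add_const b).cexp
  simpa [mul_comm] using this

/-- Solutions of `u' = a u` on `(0,1)` are multiples of an exponential. -/
lemma exists_eq_mul_exp {u : ℝ → ℂ} {a : ℂ} (h : ∀ x ∈ Ω, HasDerivAt (u) (a * u x) x) :
    ∃ c : ℂ, ∀ x ∈ Ω, u x = c * Complex.exp (a * x) := by
  -- Integrating factor: e^{-ax}u has derivative zero.
  have hd : ∀ x ∈ Ω, HasDerivAt (fun x : ℝ => Complex.exp (-a * x + 0) * u x) 0 x :=
    fun x hx => ((hasDerivAt_exp_mul (-a) 0 x).mul (h x hx)).congr_deriv (by ring)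
  obtain ⟨c, hc⟩ := isOpen_Ioo.exists_is_const_of_deriv_eq_zero isPreconnected_Ioo
    (fun x hx => (hd x hx).differentiableAt.differentiableWithinAt)
    (fun x hx => (hd x hx).deriv)
  refine ⟨c, fun x hx => ?_⟩
  rw [← hc x hx, mul_right_comm, ← Complex.exp_add]
  simp

lemma hasDerivAt_val_of_eqOn {f : HF} {g : ℝ → ℂ} (h : ∀ x ∈ Icc (0 : ℝ) 1, val f x = g x)
    {x : ℝ} (hx : x ∈ Ω) {z : ℂ} (hg : HasDerivAt g z x) : HasDerivAt (val f) z x := by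
  refine hg.congr_of_eventuallyEq ?_
  filter_upwards [isOpen_Ioo.mem_nhds hx] with y hy
  exact h y (Ioo_subset_Icc_self hy)

/-- The graph element `(e^{-x}, i e^{-x})`. -/
def Vp : HF × HF := (vp, Complex.I • vp)

/-- The graph element `(e^{x-1}, -i e^{x-1})`. -/
def Vm : HF × HF := (vm, (-Complex.I) • vm)

lemma Vp_mem : Vp ∈ minusIDF.graph.adjoint := by
  rw [mem_adjoint_graph_minusIDF]
  intro x hx
  refine hasDerivAt_val_of_eqOn (fun y hy => val_vp hy) hx ?_
  have := hasDerivAt_exp_mul (-1) 0 x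
  simp only [add_zero, neg_one_mul] at this
  refine this.congr_deriv ?_
  simp only [Vp, val_smul]
  rw [← mul_assoc, Complex.I_mul_I, val_vp (Ioo_subset_Icc_self hx), neg_one_mul]

lemma Vm_mem : Vm ∈ minusIDF.graph.adjoint := by
  rw [mem_adjoint_graph_minusIDF]
  intro x hx
  refine hasDerivAt_val_of_eqOn (fun y hy => val_vm hy) hx ?_
  have := hasDerivAt_exp_mul 1 (-1) x
  simp only [one_mul, ← sub_eq_add_neg] at this
  refine this.congr_deriv ?_
  simp only [Vm, val_smul]
  rw [← mul_assoc, mul_neg, Complex.I_mul_I, val_vm (Ioo_subset_Icc_self hx), neg_neg, one_mul]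

lemma exists_eq_smul_vp {g : HF} (h : (g, Complex.I • g) ∈ minusIDF.graph.adjoint) :
    ∃ c : ℂ, g = c • vp := by
  rw [mem_adjoint_graph_minusIDF] at h
  obtain ⟨c, hc⟩ := exists_eq_mul_exp (u := val g) (a := -1) fun x hx =>
    (h x hx).congr_deriv (by rw [val_smul, ← mul_assoc, Complex.I_mul_I])
  refine ⟨c, ext_val fun x hx => ?_⟩
  rw [hc x hx, val_smul, val_vp (Ioo_subset_Icc_self hx), neg_one_mul]

lemma exists_eq_smul_vm {g : HF} (h : (g, (-Complex.I) • g) ∈ minusIDF.graph.adjoint) :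
    ∃ c : ℂ, g = c • vm := by
  rw [mem_adjoint_graph_minusIDF] at h
  obtain ⟨c, hc⟩ := exists_eq_mul_exp (u := val g) (a := 1) fun x hx =>
    (h x hx).congr_deriv (by
      rw [val_smul, ← mul_assoc, mul_neg, Complex.I_mul_I, neg_neg])
  refine ⟨c * Complex.exp 1, ext_val fun x hx => ?_⟩
  rw [hc x hx, val_smul, val_vm (Ioo_subset_Icc_self hx), one_mul, mul_assoc, ← Complex.exp_add]
  congr 2
  ring

/-- The rotation (f, k) ↦ (k, -f) squares to -1. Splitting p along its ±i eigenspaces gives g = (f ∓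
ik)/2 with (g, ±ig) in the adjoint graph, and these two solution spaces are spanned by e^{-x} and
e^{x-1}. -/
lemma exists_deficiency {p : HF × HF} (h1 : p ∈ minusIDF.graph.adjoint)
    (h2 : (p.2, -p.1) ∈ minusIDF.graph.adjoint) :
    ∃ a b : ℂ, p = a • Vp + b • Vm := by
  obtain ⟨f, k⟩ := p
  simp only at h2
  have ha := Submodule.smul_mem _ (1 / 2 : ℂ)
    (Submodule.sub_mem _ h1 (Submodule.smul_mem _ Complex.I h2))
  have hb := Submodule.smul_mem _ (1 / 2 : ℂ)
    (Submodule.add_mem _ h1 (Submodule.smul_mem _ Complex.I h2))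
  obtain ⟨a, ha'⟩ := exists_eq_smul_vp (g := (1 / 2 : ℂ) • (f - Complex.I • k)) (by
    convert! ha using 1
    refine Prod.ext rfl ?_
    simp only [Prod.mk_sub_mk, Prod.smul_mk, smul_neg, smul_sub, smul_smul]
    match_scalars <;> first | ring1 | linear_combination (-1 / 2 : ℂ) * Complex.I_sq)
  obtain ⟨b, hb'⟩ := exists_eq_smul_vm (g := (1 / 2 : ℂ) • (f + Complex.I • k)) (by
    convert! hb using 1
    refine Prod.ext rfl ?_
    simp only [Prod.mk_add_mk, Prod.smul_mk, smul_neg, smul_add, smul_smul]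
    match_scalars <;> first | ring1 | linear_combination (-1 / 2 : ℂ) * Complex.I_sq)
  refine ⟨a, b, ?_⟩
  simp only [Vp, Vm, Prod.smul_mk, Prod.mk_add_mk, smul_comm _ Complex.I, smul_comm _ (-Complex.I),
    ← ha', ← hb', Prod.mk.injEq]
  constructor
  · module
  · match_scalars <;> first | ring1 | linear_combination Complex.I_sq

/-- Von Neumann's decomposition of the adjoint graph. -/
lemma exists_decomposition {p : HF × HF} (hp : p ∈ minusIDF.graph.adjoint) :
    ∃ q ∈ minusIDF.graph.topologicalClosure, ∃ a b : ℂ, p = q + (a • Vp + b • Vm) := by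
  obtain ⟨P, hP, hP'⟩ := exists_graph_projection minusIDF.graph.topologicalClosure
    (Submodule.isClosed_topologicalClosure _)
  have hle : ∀ r, r ∈ minusIDF.graph.topologicalClosure.adjoint →
      r ∈ minusIDF.graph.adjoint := fun r hr => by
    rw [Submodule.mem_adjoint_iff] at hr ⊢
    exact fun a b hab => hr a b (Submodule.le_topologicalClosure _ hab)
  obtain ⟨a, b, hab⟩ := exists_deficiency
    (Submodule.sub_mem _ hp (closure_graph_le_adjoint (hP p))) (hle _ (hP' p))
  exact ⟨P p, hP p, a, b, by rw [← hab, add_sub_cancel]⟩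

/-! ### Boundary values and the boundary form -/

/-- The boundary functional `(f, k) ↦ (f(0) - i k(0)) / 2`. -/
def bα : HF × HF →L[ℂ] ℂ :=
  (1 / 2 : ℂ) • ((innerSL ℂ vp) ∘L ContinuousLinearMap.fst ℂ HF HF -
    Complex.I • ((innerSL ℂ vp) ∘L ContinuousLinearMap.snd ℂ HF HF))

/-- The boundary functional `(f, k) ↦ (f(1) + i k(1)) / 2`. -/
def bβ : HF × HF →L[ℂ] ℂ :=
  (1 / 2 : ℂ) • ((innerSL ℂ vm) ∘L ContinuousLinearMap.fst ℂ HF HF +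
    Complex.I • ((innerSL ℂ vm) ∘L ContinuousLinearMap.snd ℂ HF HF))

lemma bα_apply (p : HF × HF) : bα p = (val p.1 0 - Complex.I * val p.2 0) / 2 := by
  simp [bα, val, vp]; ring

lemma bβ_apply (p : HF × HF) : bβ p = (val p.1 1 + Complex.I * val p.2 1) / 2 := by
  simp [bβ, val, vm]; ring

lemma Fint_deriv_zero {φ : ℝ → ℂ} (h : IsTest φ) : Fint (deriv φ) 0 = Fint φ 0 := by
  have := h.integral_deriv_mul (u := val vp) (w := fun x => -val vp x) (continuous_val _)
    (continuous_val _).neg fun x hx => by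
      have := mem_adjoint_graph_minusIDF.1 Vp_mem x hx
      simpa [Vp, val_smul, ← mul_assoc] using this
  simp only [mul_neg, intervalIntegral.integral_neg, neg_neg] at this
  have e : ∀ g : ℝ → ℂ, Fint g 0 = ∫ x in (0 : ℝ)..1, g x * val vp x := fun g => by
    refine intervalIntegral.integral_congr fun t ht => ?_
    rw [uIcc_of_le zero_le_one] at ht
    simp only [vp, val_kap (left_mem_Icc.2 zero_le_one) ht, sub_zero, zero_sub, F_neg]
  rw [e, e, this]

lemma Fint_deriv_one {φ : ℝ → ℂ} (h : IsTest φ) : Fint (deriv φ) 1 = -Fint φ 1 := by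
  have := h.integral_deriv_mul (u := val vm) (w := val vm) (continuous_val _)
    (continuous_val _) fun x hx => by
      have := mem_adjoint_graph_minusIDF.1 Vm_mem x hx
      simpa [Vm, val_neg, val_smul, ← mul_assoc] using this
  have e : ∀ g : ℝ → ℂ, Fint g 1 = ∫ x in (0 : ℝ)..1, g x * val vm x := fun g => by
    refine intervalIntegral.integral_congr fun t ht => ?_
    rw [uIcc_of_le zero_le_one] at ht
    simp only [vm, val_kap (right_mem_Icc.2 zero_le_one) ht]
    rw [← F_neg, neg_sub]
  rw [e, e, this]

/-- On the graph itself, F_{φ'}(0) = F_φ(0) and F_{φ'}(1) = -F_φ(1) by parts against e^{-x} and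
e^{x-1}, which is exactly the vanishing of both functionals; continuity extends this to the closure.
-/
lemma boundary_eq_zero {p : HF × HF} (hp : p ∈ minusIDF.graph.topologicalClosure) :
    bα p = 0 ∧ bβ p = 0 := by
  have hle : ∀ L : HF × HF →L[ℂ] ℂ, (∀ q ∈ minusIDF.graph, L q = 0) → L p = 0 := fun L hL =>
    Submodule.topologicalClosure_minimal (t := L.toLinearMap.ker) _ hL L.isClosed_ker hp
  constructor
  · refine hle _ fun q hq => ?_
    obtain ⟨φ, h, h1, h2⟩ := mem_graph_minusIDF.1 hq
    rw [bα_apply, h1, h2, val_smul, val_J h.smooth.continuous (by simp),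
      val_J h.deriv.smooth.continuous (by simp), Fint_deriv_zero h]
    linear_combination (Fint φ 0 / 2) * Complex.I_sq
  · refine hle _ fun q hq => ?_
    obtain ⟨φ, h, h1, h2⟩ := mem_graph_minusIDF.1 hq
    rw [bβ_apply, h1, h2, val_smul, val_J h.smooth.continuous (by simp),
      val_J h.deriv.smooth.continuous (by simp), Fint_deriv_one h]
    linear_combination (Fint φ 1 / 2) * Complex.I_sq

lemma val_vp_zero : val vp 0 = 1 := by simp [val_vp]

lemma val_vm_one : val vm 1 = 1 := by simp [val_vm]

lemma boundary_Vp : bα Vp = 1 ∧ bβ Vp = 0 := by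
  rw [bα_apply, bβ_apply]
  simp only [Vp, val_smul, ← mul_assoc, Complex.I_mul_I, val_vp_zero]
  constructor <;> ring

lemma boundary_Vm : bα Vm = 0 ∧ bβ Vm = 1 := by
  rw [bα_apply, bβ_apply]
  simp only [Vm, val_smul, ← mul_assoc, mul_neg, Complex.I_mul_I, val_vm_one]
  constructor <;> ring

/-- The decomposition of the adjoint graph, with its coefficients. -/
lemma sub_boundary_mem {p : HF × HF} (hp : p ∈ minusIDF.graph.adjoint) :
    p - (bα p • Vp + bβ p • Vm) ∈ minusIDF.graph.topologicalClosure := by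
  obtain ⟨q, hq, a, b, rfl⟩ := exists_decomposition hp
  obtain ⟨h1, h2⟩ := boundary_eq_zero hq
  simpa [h1, h2, boundary_Vp, boundary_Vm] using hq

/-- The boundary form of the maximal operator. -/
def bform (p q : HF × HF) : ℂ := ⟪p.2, q.1⟫_ℂ - ⟪p.1, q.2⟫_ℂ

lemma bform_add_left (p p' q : HF × HF) : bform (p + p') q = bform p q + bform p' q := by
  simp only [bform, Prod.fst_add, Prod.snd_add, inner_add_left]; ring

lemma bform_add_right (p q q' : HF × HF) : bform p (q + q') = bform p q + bform p q' := by
  simp only [bform, Prod.fst_add, Prod.snd_add, inner_add_right]; ring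

lemma bform_smul_left (c : ℂ) (p q : HF × HF) : bform (c • p) q = conj c * bform p q := by
  simp only [bform, Prod.smul_fst, Prod.smul_snd, inner_smul_left]; ring

lemma bform_smul_right (c : ℂ) (p q : HF × HF) : bform p (c • q) = c * bform p q := by
  simp only [bform, Prod.smul_fst, Prod.smul_snd, inner_smul_right]; ring

lemma bform_symm (p q : HF × HF) : bform q p = -conj (bform p q) := by
  simp only [bform, map_sub, inner_conj_symm]; ring

lemma mem_adjoint_iff_bform {S : Submodule ℂ (HF × HF)} {p : HF × HF} :
    p ∈ S.adjoint ↔ ∀ q ∈ S, bform q p = 0 := by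
  rw [Submodule.mem_adjoint_iff]
  exact ⟨fun h q hq => h q.1 q.2 hq, fun h a b hab => h (a, b) hab⟩

lemma bform_closure_left {p q : HF × HF} (hp : p ∈ minusIDF.graph.topologicalClosure)
    (hq : q ∈ minusIDF.graph.adjoint) : bform p q = 0 := by
  have hcl : IsClosed {r : HF × HF | bform r q = 0} := by
    refine isClosed_eq ?_ continuous_const
    unfold bform
    fun_prop
  exact closure_minimal (fun r hr => mem_adjoint_iff_bform.1 hq r hr) hcl hp

lemma bform_closure_right {p q : HF × HF} (hp : p ∈ minusIDF.graph.adjoint)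
    (hq : q ∈ minusIDF.graph.topologicalClosure) : bform p q = 0 := by
  rw [bform_symm q p, bform_closure_left hq hp, map_zero, neg_zero]

lemma inner_vp_vp : ⟪vp, vp⟫_ℂ = 1 := val_vp_zero

lemma inner_vm_vm : ⟪vm, vm⟫_ℂ = 1 := val_vm_one

/-- The boundary form in terms of boundary values. -/
lemma bform_eq {p q : HF × HF} (hp : p ∈ minusIDF.graph.adjoint)
    (hq : q ∈ minusIDF.graph.adjoint) :
    bform p q = -2 * Complex.I * (conj (bα p) * bα q - conj (bβ p) * bβ q) := by
  have hp' := sub_boundary_mem hp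
  have hq' := sub_boundary_mem hq
  have hV : ∀ a b : ℂ, a • Vp + b • Vm ∈ minusIDF.graph.adjoint := fun a b =>
    add_mem (Submodule.smul_mem _ _ Vp_mem) (Submodule.smul_mem _ _ Vm_mem)
  -- The closure of the graph lies in the radical of the form, so only the components along `Vp` and
  -- `Vm` contribute.
  have e1 : bform p q = bform (bα p • Vp + bβ p • Vm) (bα q • Vp + bβ q • Vm) := by
    conv_lhs => rw [← sub_add_cancel p (bα p • Vp + bβ p • Vm),
      ← sub_add_cancel q (bα q • Vp + bβ q • Vm)]
    rw [bform_add_left, bform_closure_left hp' (by simpa using hq), zero_add, bform_add_right,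
      bform_closure_right (hV _ _) hq', zero_add]
  have h1 : bform Vp Vp = -2 * Complex.I := by
    simp only [bform, Vp, inner_smul_left, inner_smul_right, inner_vp_vp, Complex.conj_I]; ring
  have h2 : bform Vm Vm = 2 * Complex.I := by
    simp only [bform, Vm, inner_smul_left, inner_smul_right, inner_vm_vm, map_neg,
      Complex.conj_I]; ring
  have h3 : bform Vp Vm = 0 := by
    simp only [bform, Vp, Vm, inner_smul_left, inner_smul_right, Complex.conj_I]; ring
  have h4 : bform Vm Vp = 0 := by rw [bform_symm, h3, map_zero, neg_zero]
  rw [e1]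
  simp only [bform_add_left, bform_add_right, bform_smul_left, bform_smul_right, h1, h2, h3, h4]
  ring

/-! ### The selfadjoint extensions -/

lemma norm_exp_mul_I (θ : ℝ) :
    conj (Complex.exp (θ * Complex.I)) * Complex.exp (θ * Complex.I) = 1 := by
  rw [← Complex.exp_conj, ← Complex.exp_add]
  simp

/-- The graph of `A θ` is cut out of the maximal graph by a boundary condition. -/
lemma mem_graphA {θ : ℝ} {p : HF × HF} :
    p ∈ graphA θ ↔
      p ∈ minusIDF.graph.adjoint ∧ bβ p = Complex.exp (θ * Complex.I) * bα p := by
  have hvp : ∀ x : Ω, vp x = Complex.exp (-(x : ℝ)) := fun x => by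
    rw [← val_eq, val_vp (Ioo_subset_Icc_self x.2)]
  have hvm : ∀ x : Ω, vm x = Complex.exp ((x : ℝ) - 1) := fun x => by
    rw [← val_eq, val_vm (Ioo_subset_Icc_self x.2)]
  have key : p ∈ graphA θ ↔ ∃ q ∈ minusIDF.graph.topologicalClosure, ∃ c : ℂ,
      p = q + (c • Vp + (c * Complex.exp (θ * Complex.I)) • Vm) := by
    refine exists_congr fun q => and_congr_right fun hq => exists_congr fun c => ?_
    rw [Prod.ext_iff, DFunLike.ext_iff, DFunLike.ext_iff]
    refine and_congr (forall_congr' fun x => ?_) (forall_congr' fun x => ?_)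
    · simp [Vp, Vm, defect, hvp, hvm, mul_add, mul_assoc]
    · have : Complex.I * c * defect θ (-1) x = c * (Complex.I * vp x) +
          c * Complex.exp (θ * Complex.I) * (-Complex.I * vm x) := by
        simp only [defect, hvp, hvm]; push_cast; ring
      rw [this]
      simp [Vp, Vm]
  rw [key]
  constructor
  · rintro ⟨q, hq, c, rfl⟩
    obtain ⟨h1, h2⟩ := boundary_eq_zero hq
    refine ⟨add_mem (closure_graph_le_adjoint hq) (add_mem (Submodule.smul_mem _ _ Vp_mem)
      (Submodule.smul_mem _ _ Vm_mem)), ?_⟩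
    simp [h1, h2, boundary_Vp, boundary_Vm, mul_comm]
  · rintro ⟨hp, h⟩
    refine ⟨_, sub_boundary_mem hp, bα p, ?_⟩
    rw [h, mul_comm (bα p), sub_add_cancel]

lemma closure_le_graphA (θ : ℝ) : minusIDF.graph.topologicalClosure ≤ graphA θ := fun _ hp =>
  mem_graphA.2 ⟨closure_graph_le_adjoint hp, by simp [boundary_eq_zero hp]⟩

lemma minusIDF_le_A (θ : ℝ) : minusIDF ≤ A θ := by
  rw [← LinearPMap.le_graph_iff, A_graph]
  exact (Submodule.le_topologicalClosure _).trans (closure_le_graphA θ)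

lemma adjoint_anti {S T : Submodule ℂ (HF × HF)} (h : S ≤ T) : T.adjoint ≤ S.adjoint :=
  fun _ hp => mem_adjoint_iff_bform.2 fun q hq => mem_adjoint_iff_bform.1 hp q (h hq)

/-- The form vanishes on pairs with β = e^{iθ}α because |e^{iθ}| = 1. Conversely, orthogonality to
the single vector `Vp` + e^{iθ}`Vm` already forces that condition. -/
lemma graphA_adjoint (θ : ℝ) : (graphA θ).adjoint = graphA θ := by
  have hV : Vp + Complex.exp (θ * Complex.I) • Vm ∈ graphA θ :=
    mem_graphA.2 ⟨add_mem Vp_mem (Submodule.smul_mem _ _ Vm_mem), by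
      simp [boundary_Vp, boundary_Vm]⟩
  ext p
  constructor
  · intro hp
    have hp' : p ∈ minusIDF.graph.adjoint :=
      adjoint_anti ((Submodule.le_topologicalClosure _).trans (closure_le_graphA θ)) hp
    refine mem_graphA.2 ⟨hp', ?_⟩
    have h := mem_adjoint_iff_bform.1 hp _ hV
    rw [bform_eq (mem_graphA.1 hV).1 hp'] at h
    simp only [map_add, map_smul, boundary_Vp, boundary_Vm, smul_eq_mul, mul_one, mul_zero,
      add_zero, zero_add, map_one, one_mul, mul_eq_zero, neg_eq_zero, OfNat.ofNat_ne_zero,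
      Complex.I_ne_zero, false_or, sub_eq_zero] at h
    rw [h, ← mul_assoc, mul_comm (Complex.exp _), norm_exp_mul_I, one_mul]
  · intro hp
    refine mem_adjoint_iff_bform.2 fun q hq => ?_
    rw [mem_graphA] at hp hq
    rw [bform_eq hq.1 hp.1, hp.2, hq.2, map_mul]
    linear_combination (2 * Complex.I * conj (bα q) * bα p) * norm_exp_mul_I θ

lemma isSelfAdjoint_A (θ : ℝ) : IsSelfAdjoint (A θ) := by
  rw [LinearPMap.isSelfAdjoint_def]
  refine LinearPMap.eq_of_eq_graph ?_
  rw [LinearPMap.adjoint_graph_eq_graph_adjoint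
    (dense_domain_minusIDF.mono (minusIDF_le_A θ).1), A_graph, graphA_adjoint]

/-- Selfadjointness makes the graph of T isotropic, so |α| = |β| on it. One element with α ≠ 0
determines θ, and isotropy against that element puts T inside A_θ. -/
lemma exists_eq_A {T : HF →ₗ.[ℂ] HF} (hT : IsSelfAdjoint T) (hle : minusIDF ≤ T) :
    ∃ θ ∈ Ico (0 : ℝ) (2 * Real.pi), T = A θ := by
  have hadj : T.graph.adjoint = T.graph := by
    rw [← LinearPMap.adjoint_graph_eq_graph_adjoint hT.dense_domain,
      LinearPMap.isSelfAdjoint_def.1 hT]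
  have hG : minusIDF.graph ≤ T.graph := LinearPMap.le_graph_iff.2 hle
  have hGs : T.graph ≤ minusIDF.graph.adjoint := hadj ▸ adjoint_anti hG
  have hmem : ∀ p ∈ minusIDF.graph.adjoint,
      (∀ q ∈ T.graph, conj (bα q) * bα p = conj (bβ q) * bβ p) → p ∈ T.graph := by
    intro p hp h
    rw [← hadj, mem_adjoint_iff_bform]
    intro q hq
    rw [bform_eq (hGs hq) hp, h q hq, sub_self, mul_zero]
  have hrel : ∀ p ∈ T.graph, ∀ q ∈ T.graph, conj (bα q) * bα p = conj (bβ q) * bβ p := by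
    intro p hp q hq
    have h := mem_adjoint_iff_bform.1 (hadj.symm ▸ hp) q hq
    rw [bform_eq (hGs hq) (hGs hp)] at h
    simpa [sub_eq_zero] using h
  have hnorm : ∀ p ∈ T.graph, ‖bα p‖ = ‖bβ p‖ := fun p hp => by
    have h := hrel p hp p hp
    rw [← Complex.normSq_eq_conj_mul_self, ← Complex.normSq_eq_conj_mul_self] at h
    have h' := Complex.ofReal_injective h
    rw [Complex.normSq_eq_norm_sq, Complex.normSq_eq_norm_sq] at h'
    exact (sq_eq_sq₀ (norm_nonneg _) (norm_nonneg _)).1 h'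
  -- If α vanished on T, so would β; then `Vp` would be in the adjoint of T, hence in T, although
  -- α(`Vp`) = 1.
  obtain ⟨p, hp, hp0⟩ : ∃ p ∈ T.graph, bα p ≠ 0 := by
    by_contra! hcon
    have hz : ∀ q ∈ T.graph, bβ q = 0 := fun q hq => by
      rw [← norm_eq_zero, ← hnorm q hq, hcon q hq, norm_zero]
    have := hcon Vp (hmem Vp Vp_mem fun q hq => by simp [hcon q hq, hz q hq])
    simp [boundary_Vp] at this
  obtain ⟨θ, hθ, hθ'⟩ : ∃ θ ∈ Ico (0 : ℝ) (2 * Real.pi),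
      bβ p = Complex.exp (θ * Complex.I) * bα p := by
    have h1 : ‖bβ p / bα p‖ = 1 := by
      rw [norm_div, hnorm p hp, div_self]
      rw [← hnorm p hp]; exact norm_ne_zero_iff.2 hp0
    -- The argument of β/α, shifted by a multiple of 2π into [0, 2π).
    refine ⟨toIcoMod Real.two_pi_pos 0 (Complex.arg (bβ p / bα p)), ?_, ?_⟩
    · simpa using toIcoMod_mem_Ico Real.two_pi_pos 0 (Complex.arg (bβ p / bα p))
    · have h2 := Complex.norm_mul_exp_arg_mul_I (bβ p / bα p)
      rw [h1, Complex.ofReal_one, one_mul] at h2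
      rw [toIcoMod, ← div_eq_iff hp0, ← h2]
      rw [Complex.exp_eq_exp_iff_exists_int]
      refine ⟨toIcoDiv Real.two_pi_pos 0 (Complex.arg (bβ p / bα p)), ?_⟩
      rw [h2]
      simp only [zsmul_eq_mul]
      push_cast
      ring
  refine ⟨θ, hθ, LinearPMap.eq_of_eq_graph ?_⟩
  rw [A_graph]
  have hle' : T.graph ≤ graphA θ := fun q hq => by
    refine mem_graphA.2 ⟨hGs hq, ?_⟩
    have h := hrel q hq p hp
    rw [hθ', map_mul] at h
    have hc : conj (bα p) ≠ 0 := (map_ne_zero _).2 hp0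
    refine mul_left_cancel₀ hc ?_
    linear_combination -Complex.exp (θ * Complex.I) * h - conj (bα p) * bβ q * norm_exp_mul_I θ
  refine le_antisymm hle' ?_
  -- Taking adjoints reverses the inclusion, and both graphs equal their adjoints.
  have := adjoint_anti hle'
  rwa [graphA_adjoint, hadj] at this

/-! ### Explicit form of the superpositions of kernel functions -/

/-- The function `∫_0^1 h(t) e^{-|x-t|} dt` of `x ∈ [0,1]`, as a smooth function on the line. -/
def Fs (h : ℝ → ℂ) (x : ℝ) : ℂ :=
  Complex.exp (-x) * (∫ t in (0 : ℝ)..x, h t * Complex.exp t) +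
    Complex.exp x * ∫ t in x..1, h t * Complex.exp (-t)

/-- The derivative of `Fs h`. -/
def Gs (h : ℝ → ℂ) (x : ℝ) : ℂ :=
  -(Complex.exp (-x) * ∫ t in (0 : ℝ)..x, h t * Complex.exp t) +
    Complex.exp x * ∫ t in x..1, h t * Complex.exp (-t)

lemma Fint_eq_Fs {h : ℝ → ℂ} (hh : Continuous h) {x : ℝ} (hx : x ∈ Icc (0 : ℝ) 1) :
    Fint h x = Fs h x := by
  have hi : ∀ a b : ℝ, IntervalIntegrable (fun t => h t * F (x - t)) volume a b := fun a b =>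
    (hh.mul (continuous_F.comp (by fun_prop))).intervalIntegrable _ _
  rw [Fint, ← intervalIntegral.integral_add_adjacent_intervals (hi 0 x) (hi x 1), Fs,
    ← intervalIntegral.integral_const_mul, ← intervalIntegral.integral_const_mul]
  congr 1
  · refine intervalIntegral.integral_congr fun t ht => ?_
    rw [uIcc_of_le hx.1] at ht
    simp only [F]
    rw [abs_of_nonneg (by linarith [ht.2]), mul_left_comm, ← Complex.exp_add]
    push_cast
    congr 2
    ring
  · refine intervalIntegral.integral_congr fun t ht => ?_
    rw [uIcc_of_le hx.2] at ht
    simp only [F]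
    rw [abs_of_nonpos (by linarith [ht.1]), mul_left_comm, ← Complex.exp_add]
    push_cast
    congr 2
    ring

lemma hasDerivAt_integral_left {g : ℝ → ℂ} (hg : Continuous g) (x : ℝ) :
    HasDerivAt (fun x => ∫ t in x..(1 : ℝ), g t) (-g x) x :=
  intervalIntegral.integral_hasDerivAt_left (hg.intervalIntegrable _ _)
    (hg.stronglyMeasurableAtFilter _ _) hg.continuousAt

lemma hasDerivAt_cexp (x : ℝ) : HasDerivAt (fun x : ℝ => Complex.exp x) (Complex.exp x) x := by
  simpa using (Complex.ofRealCLM.hasDerivAt (x := x)).cexp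

lemma hasDerivAt_cexp_neg (x : ℝ) :
    HasDerivAt (fun x : ℝ => Complex.exp (-x)) (-Complex.exp (-x)) x := by
  simpa using (Complex.ofRealCLM.hasDerivAt (x := x)).neg.cexp

lemma hasDerivAt_Fs_aux {h : ℝ → ℂ} (hh : Continuous h) (x : ℝ) :
    HasDerivAt (fun x : ℝ => Complex.exp (-x) * ∫ t in (0 : ℝ)..x, h t * Complex.exp t)
      (-(Complex.exp (-x) * ∫ t in (0 : ℝ)..x, h t * Complex.exp t) + h x) x ∧
    HasDerivAt (fun x : ℝ => Complex.exp x * ∫ t in x..1, h t * Complex.exp (-t))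
      (Complex.exp x * (∫ t in x..1, h t * Complex.exp (-t)) - h x) x := by
  have h1 : Continuous fun t : ℝ => h t * Complex.exp t := by fun_prop
  have h2 : Continuous fun t : ℝ => h t * Complex.exp (-t) := by fun_prop
  have e : Complex.exp (-x) * Complex.exp x = 1 := by rw [← Complex.exp_add]; simp
  constructor
  · refine ((hasDerivAt_cexp_neg x).mul
      (h1.integral_hasStrictDerivAt 0 x).hasDerivAt).congr_deriv ?_
    linear_combination h x * e
  · refine ((hasDerivAt_cexp x).mul (hasDerivAt_integral_left h2 x)).congr_deriv ?_
    linear_combination -h x * e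

lemma hasDerivAt_Fs {h : ℝ → ℂ} (hh : Continuous h) (x : ℝ) : HasDerivAt (Fs h) (Gs h x) x := by
  obtain ⟨h1, h2⟩ := hasDerivAt_Fs_aux hh x
  exact (h1.add h2).congr_deriv (by rw [Gs]; ring)

/-- Thus e^{-|x-t|}/2 is a Green's function of 1 - d²/dx²; `Gs_zero` and `Gs_one` are its boundary
conditions. -/
lemma hasDerivAt_Gs {h : ℝ → ℂ} (hh : Continuous h) (x : ℝ) :
    HasDerivAt (Gs h) (Fs h x - 2 * h x) x := by
  obtain ⟨h1, h2⟩ := hasDerivAt_Fs_aux hh x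
  exact (h1.neg.add h2).congr_deriv (by rw [Fs]; ring)

lemma Gs_zero (h : ℝ → ℂ) : Gs h 0 = Fs h 0 := by simp [Gs, Fs]

lemma Gs_one (h : ℝ → ℂ) : Gs h 1 = -Fs h 1 := by simp [Gs, Fs]

lemma continuous_Fs {h : ℝ → ℂ} (hh : Continuous h) : Continuous (Fs h) :=
  continuous_iff_continuousAt.2 fun x => (hasDerivAt_Fs hh x).continuousAt

lemma continuous_Gs {h : ℝ → ℂ} (hh : Continuous h) : Continuous (Gs h) :=
  continuous_iff_continuousAt.2 fun x => (hasDerivAt_Gs hh x).continuousAt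

/-! ### The exponentials -/

lemma continuous_expFun (l : ℝ) : Continuous (expFun l) := by
  unfold expFun; fun_prop

lemma one_add_mul_I_ne (l : ℝ) : 1 + Complex.I * l ≠ 0 := fun h => by
  have := congrArg Complex.re h
  simp at this

lemma one_sub_mul_I_ne (l : ℝ) : 1 - Complex.I * l ≠ 0 := fun h => by
  have := congrArg Complex.re h
  simp at this

/-- Evaluating the two exponential integrals and solving for e_λ writes it through F_{e_λ}, e^{-x}
and e^{x-1}, all in the space. This is the source of the coefficients in `expHF`. -/
lemma Fs_expFun (l x : ℝ) :
    (1 + l ^ 2) / 2 * Fs (expFun l) x = expFun l x - (1 - Complex.I * l) / 2 * Complex.exp (-x) -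
      (1 + Complex.I * l) / 2 * Complex.exp (Complex.I * l) * Complex.exp (x - 1) := by
  have h1 : ∀ t : ℝ, expFun l t * Complex.exp t = Complex.exp ((1 + Complex.I * l) * t) :=
    fun t => by rw [expFun, ← Complex.exp_add]; congr 1; ring
  have h2 : ∀ t : ℝ, expFun l t * Complex.exp (-t) = Complex.exp (-(1 - Complex.I * l) * t) :=
    fun t => by rw [expFun, ← Complex.exp_add]; congr 1; ring
  have hp := one_add_mul_I_ne l
  have hm := one_sub_mul_I_ne l
  have hl : (1 + l ^ 2 : ℂ) = (1 + Complex.I * l) * (1 - Complex.I * l) := by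
    linear_combination (l ^ 2 : ℂ) * Complex.I_sq
  simp only [Fs, h1, h2]
  rw [integral_exp_mul_complex hp, integral_exp_mul_complex (neg_ne_zero.2 hm), hl]
  have e1 : Complex.exp ((1 + Complex.I * l) * x) = expFun l x * Complex.exp x := (h1 x).symm
  have e2 : Complex.exp (-(1 - Complex.I * l) * x) = expFun l x * Complex.exp (-x) := (h2 x).symm
  have e3 : Complex.exp (-(1 - Complex.I * l) * (1 : ℝ)) =
      Complex.exp (Complex.I * l) * Complex.exp (-1) := by
    rw [← Complex.exp_add]; congr 1; push_cast; ring
  have e4 : Complex.exp (x - 1) = Complex.exp x * Complex.exp (-1) := by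
    rw [← Complex.exp_add, sub_eq_add_neg]
  have e : Complex.exp (-x) * Complex.exp x = 1 := by rw [← Complex.exp_add]; simp
  rw [e1, e2, e3, e4]
  simp only [Complex.ofReal_zero, mul_zero, Complex.exp_zero]
  field_simp
  linear_combination (2 * expFun l x) * e

/-- The exponential `e^{iλx}` as an element of `HF`. -/
def expHF (l : ℝ) : HF :=
  ((1 + l ^ 2) / 2 : ℂ) • J (expFun l) + ((1 - Complex.I * l) / 2) • vp +
    ((1 + Complex.I * l) / 2 * Complex.exp (Complex.I * l)) • vm

lemma val_expHF (l : ℝ) {x : ℝ} (hx : x ∈ Icc (0 : ℝ) 1) : val (expHF l) x = expFun l x := by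
  rw [expHF, val_add, val_add, val_smul, val_smul, val_smul, val_J (continuous_expFun l) hx,
    Fint_eq_Fs (continuous_expFun l) hx, Fs_expFun, val_vp hx, val_vm hx]
  ring

lemma expHF_apply (l : ℝ) (x : Ω) : expHF l x = expFun l x := by
  rw [← val_eq, val_expHF l (Ioo_subset_Icc_self x.2)]

lemma expFun_zero (l : ℝ) : expFun l 0 = 1 := by simp [expFun]

lemma expFun_one (l : ℝ) : expFun l 1 = Complex.exp (Complex.I * l) := by simp [expFun]

lemma conj_expFun_mul_self (l x : ℝ) : conj (expFun l x) * expFun l x = 1 := by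
  rw [expFun, ← Complex.exp_conj, ← Complex.exp_add]
  simp

/-- Only the left factor is expanded: F_{e_λ} pairs with e_λ to ∫|e_λ|² = 1, and the endpoint
kernels evaluate it at 0 and 1. The sum is (1 + λ²)/2 + (1 + iλ)/2 + (1 - iλ)/2. -/
lemma inner_expHF_self (l : ℝ) : ⟪expHF l, expHF l⟫_ℂ = ((l ^ 2 + 3) / 2 : ℝ) := by
  have h0 : ⟪vp, expHF l⟫_ℂ = 1 := by
    rw [← expFun_zero l, ← val_expHF l (by simp)]; rfl
  have h1 : ⟪vm, expHF l⟫_ℂ = expFun l 1 := by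
    rw [← val_expHF l (by simp)]; rfl
  have hJ : ⟪J (expFun l), expHF l⟫_ℂ = 1 := by
    rw [inner_J_left (continuous_expFun l)]
    have : ∫ t in (0 : ℝ)..1, conj (expFun l t) * val (expHF l) t = ∫ t in (0 : ℝ)..1, (1 : ℂ) := by
      refine intervalIntegral.integral_congr fun t ht => ?_
      rw [uIcc_of_le zero_le_one] at ht
      simp only [val_expHF l ht, conj_expFun_mul_self]
    rw [this]; simp
  nth_rewrite 1 [expHF]
  have hc := conj_expFun_mul_self l 1
  simp only [inner_add_left, inner_smul_left, h0, h1, hJ, ← expFun_one l, map_mul]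
  have h2 : conj ((1 + Complex.I * l) / 2) = (1 - Complex.I * l) / 2 := by
    simp [sub_eq_add_neg, map_ofNat]
  have h3 : conj ((1 - Complex.I * l) / 2) = (1 + Complex.I * l) / 2 := by
    simp [map_ofNat]
  have h4 : conj ((1 + l ^ 2 : ℂ) / 2) = (1 + l ^ 2) / 2 := by simp [map_ofNat]
  rw [h2, h3, h4]
  push_cast
  linear_combination (1 - Complex.I * l) / 2 * hc

lemma norm_expHF (l : ℝ) : ‖expHF l‖ = Real.sqrt ((l ^ 2 + 3) / 2) := by
  rw [@norm_eq_sqrt_re_inner ℂ, inner_expHF_self]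
  congr 1

lemma expHF_ne_zero (l : ℝ) : expHF l ≠ 0 := by
  rw [← norm_ne_zero_iff, norm_expHF]
  positivity

/-! ### The eigenvalues of `A θ` -/

/-- The eigenvalues of `A θ`. -/
def eigs (θ : ℝ) : Set ℝ :=
  {l | (1 + Complex.I * l) * Complex.exp (Complex.I * l) =
    Complex.exp (θ * Complex.I) * (1 - Complex.I * l)}

lemma hasDerivAt_expFun (l x : ℝ) : HasDerivAt (expFun l) (Complex.I * l * expFun l x) x := by
  have := hasDerivAt_exp_mul (Complex.I * l) 0 x
  simp only [add_zero] at this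
  exact this

lemma expHF_mem_adjoint (l : ℝ) : (expHF l, (l : ℂ) • expHF l) ∈ minusIDF.graph.adjoint := by
  rw [mem_adjoint_graph_minusIDF]
  intro x hx
  refine hasDerivAt_val_of_eqOn (fun y hy => val_expHF l hy) hx ?_
  rw [val_smul, val_expHF l (Ioo_subset_Icc_self hx), ← mul_assoc]
  exact hasDerivAt_expFun l x

lemma expHF_mem_graphA {θ l : ℝ} : (expHF l, (l : ℂ) • expHF l) ∈ graphA θ ↔ l ∈ eigs θ := by
  rw [mem_graphA, and_iff_right (expHF_mem_adjoint l), bα_apply, bβ_apply]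
  simp only [val_smul, val_expHF l (left_mem_Icc.2 zero_le_one),
    val_expHF l (right_mem_Icc.2 zero_le_one), expFun_zero, expFun_one, eigs, mem_ofPred_eq]
  constructor
  · intro h
    linear_combination 2 * h
  · intro h
    linear_combination (1 / 2 : ℂ) * h

lemma eigenvector_eq {θ l : ℝ} {f : HF} (h : (f, (l : ℂ) • f) ∈ graphA θ) (hf : f ≠ 0) :
    l ∈ eigs θ ∧ ∃ c : ℂ, f = c • expHF l := by
  have h' := mem_adjoint_graph_minusIDF.1 (mem_graphA.1 h).1
  obtain ⟨c, hc⟩ := exists_eq_mul_exp (u := val f) (a := Complex.I * l) fun x hx => by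
    have := h' x hx
    rwa [val_smul, ← mul_assoc] at this
  have hc' : f = c • expHF l := ext_val fun x hx => by
    rw [val_smul, hc x hx, val_expHF l (Ioo_subset_Icc_self hx), expFun]
  refine ⟨?_, c, hc'⟩
  have hc0 : c ≠ 0 := by rintro rfl; exact hf (by rw [hc', zero_smul])
  rw [← expHF_mem_graphA]
  have := Submodule.smul_mem _ c⁻¹ h
  rw [hc'] at this
  simpa [smul_comm _ c, hc0, smul_smul] using this

/-- `A θ` is symmetric. -/
lemma graphA_symm {θ : ℝ} {p q : HF × HF} (hp : p ∈ graphA θ) (hq : q ∈ graphA θ) :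
    ⟪p.2, q.1⟫_ℂ = ⟪p.1, q.2⟫_ℂ :=
  sub_eq_zero.1 (mem_adjoint_iff_bform.1 ((graphA_adjoint θ).symm ▸ hq) p hp)

lemma inner_expHF_eq_zero {θ l m : ℝ} (hl : l ∈ eigs θ) (hm : m ∈ eigs θ) (hlm : l ≠ m) :
    ⟪expHF l, expHF m⟫_ℂ = 0 := by
  have h := graphA_symm (expHF_mem_graphA.2 hl) (expHF_mem_graphA.2 hm)
  simp only [inner_smul_left, inner_smul_right, Complex.conj_ofReal] at h
  have h' : ((l : ℂ) - m) * ⟪expHF l, expHF m⟫_ℂ = 0 := by linear_combination h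
  exact (mul_eq_zero.1 h').resolve_left (sub_ne_zero.2 (by exact_mod_cast hlm))

/-! ### Compactness of `(1 + A²)⁻¹` -/

lemma eq_mul_exp_of_continuous {u : ℝ → ℂ} (hu : Continuous u) {a : ℂ}
    (h : ∀ x ∈ Ω, HasDerivAt u (a * u x) x) {x y : ℝ} (hx : x ∈ Icc (0 : ℝ) 1)
    (hy : y ∈ Icc (0 : ℝ) 1) : u x = u y * Complex.exp (a * (x - y)) := by
  obtain ⟨c, hc⟩ := exists_eq_mul_exp h
  have hcl : ∀ x ∈ Icc (0 : ℝ) 1, u x = c * Complex.exp (a * x) := fun x hx =>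
    closure_minimal (t := {x : ℝ | u x = c * Complex.exp (a * x)}) hc
      (isClosed_eq hu (by fun_prop)) (closure_Ω ▸ hx)
  rw [hcl x hx, hcl y hy, mul_assoc, ← Complex.exp_add]
  congr 2
  ring

lemma isCompactOperator_rankOne {H : Type*} [NormedAddCommGroup H] [InnerProductSpace ℂ H]
    (L : H →L[ℂ] ℂ) (v : H) : IsCompactOperator (L.smulRight v) :=
  (isCompactOperator_of_locallyCompactSpace_rng (ContinuousLinearMap.toSpanSingleton ℂ v)).comp_clm L

/-- The integral operator `g ↦ F_g` on `HF`. -/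
def Kop : HF →L[ℂ] HF := ∫ t in (0 : ℝ)..1, InnerProductSpace.rankOne ℂ (kap t) (kap t)

lemma continuous_rankOne_kap :
    Continuous fun t => InnerProductSpace.rankOne ℂ (kap t) (kap t) :=
  ((ContinuousLinearMap.smulRightL ℂ HF HF).continuous.comp
    ((innerSL ℂ).continuous.comp continuous_kap)).clm_apply continuous_kap

lemma Kop_apply (g : HF) : Kop g = J (val g) := by
  rw [Kop, J, ContinuousLinearMap.intervalIntegral_apply
    (continuous_rankOne_kap.intervalIntegrable _ _)]
  rfl

/-- An average of rank-one operators over a probability measure stays in the closed convex set of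
compact operators. -/
lemma isCompactOperator_Kop : IsCompactOperator Kop := by
  have hs : Convex ℝ ((compactOperator (RingHom.id ℂ) HF HF).restrictScalars ℝ :
      Set (HF →L[ℂ] HF)) := Submodule.convex _
  have : IsProbabilityMeasure (volume.restrict (Ioc (0 : ℝ) 1)) := ⟨by simp⟩
  rw [Kop, intervalIntegral.integral_of_le zero_le_one]
  exact hs.integral_mem isClosed_setOfPred_isCompactOperator
    (Eventually.of_forall fun t => isCompactOperator_rankOne _ _)
    ((intervalIntegrable_iff_integrableOn_Ioc_of_le zero_le_one).1
      (continuous_rankOne_kap.intervalIntegrable _ _))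

/-- If `f + A²f = g`, then `f` is `F_g / 2` up to a combination of `e^{-x}` and `e^{x-1}`. -/
lemma eq_Kop_add {f k g : HF} (h1 : (f, k) ∈ minusIDF.graph.adjoint)
    (h2 : (k, g - f) ∈ minusIDF.graph.adjoint) :
    f = (1 / 2 : ℂ) • Kop g + bα (f, k) • vp + bβ (f, k) • vm := by
  rw [mem_adjoint_graph_minusIDF] at h1 h2
  have hg := continuous_val g
  have hD : ∀ x ∈ Ω, HasDerivAt (fun x => val f x - Fs (val g) x / 2)
      (Complex.I * val k x - Gs (val g) x / 2) x := fun x hx =>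
    (h1 x hx).sub ((hasDerivAt_Fs hg x).div_const 2)
  have hD' : ∀ x ∈ Ω, HasDerivAt (fun x => Complex.I * val k x - Gs (val g) x / 2)
      (val f x - Fs (val g) x / 2) x := fun x hx => by
    refine (((h2 x hx).const_mul Complex.I).sub
      ((hasDerivAt_Gs hg x).div_const 2)).congr_deriv ?_
    simp only [val_sub]
    linear_combination (val g x - val f x) * Complex.I_sq
  have hc : Continuous fun x => val f x - Fs (val g) x / 2 :=
    (continuous_val f).sub ((continuous_Fs hg).div_const 2)
  have hc' : Continuous fun x => Complex.I * val k x - Gs (val g) x / 2 :=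
    (continuous_const.mul (continuous_val k)).sub ((continuous_Gs hg).div_const 2)
  refine ext_val fun x hx => ?_
  have hx' := Ioo_subset_Icc_self hx
  -- With w = f - F_g/2 one has w'' = w, so w - w' and w + w' are multiples of e^{-x} and e^{x}. By
  -- the boundary conditions on F_g, their values at 0 and at 1 respectively are 2`bα` and 2`bβ`.
  have e1 := eq_mul_exp_of_continuous (hc.sub hc') (a := -1) (fun x hx =>
    ((hD x hx).sub (hD' x hx)).congr_deriv (by simp only [Pi.sub_apply]; ring)) hx'
    (left_mem_Icc.2 zero_le_one)
  have e2 := eq_mul_exp_of_continuous (hc.add hc') (a := 1) (fun x hx =>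
    ((hD x hx).add (hD' x hx)).congr_deriv (by simp only [Pi.add_apply]; ring)) hx'
    (right_mem_Icc.2 zero_le_one)
  simp only [Pi.sub_apply, Pi.add_apply, Gs_zero, Gs_one, Complex.ofReal_zero, sub_zero,
    neg_one_mul, one_mul, Complex.ofReal_one] at e1 e2
  rw [val_add, val_add, val_smul, val_smul, val_smul, Kop_apply, val_J hg hx',
    Fint_eq_Fs hg hx', val_vp hx', val_vm hx', bα_apply, bβ_apply]
  linear_combination (1 / 2 : ℂ) * e1 + (1 / 2 : ℂ) * e2

lemma isClosed_graphA (θ : ℝ) : IsClosed (graphA θ : Set (HF × HF)) := by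
  rw [← A_graph]
  exact (isSelfAdjoint_A θ).isClosed

lemma snd_eq_zero_of_mem_graphA {θ : ℝ} {k : HF} (h : ((0 : HF), k) ∈ graphA θ) : k = 0 := by
  rw [← A_graph] at h
  exact LinearPMap.graph_fst_eq_zero_snd _ h rfl

/-- The operator `(1 + A²)⁻¹`. -/
lemma exists_square_resolvent (θ : ℝ) : ∃ B : HF →L[ℂ] HF, IsCompactOperator B ∧
    B.IsSymmetric ∧ ∀ g, ∃ k, (B g, k) ∈ graphA θ ∧ (k, g - B g) ∈ graphA θ := by
  obtain ⟨P, hP, hP'⟩ := exists_graph_projection (graphA θ) (isClosed_graphA θ)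
  let R : HF →L[ℂ] HF × HF := P ∘L ContinuousLinearMap.inl ℂ HF HF
  have h1 : ∀ g, ((R g).1, (R g).2) ∈ graphA θ := fun g => hP _
  have h2 : ∀ g, ((R g).2, g - (R g).1) ∈ graphA θ := fun g => by
    -- With (f, k) the projection of (g, 0), the residual (g - f, -k) is orthogonal to the graph; as
    -- A = A*, this says Ak = g - f, that is f + A²f = g.
    have := neg_mem (hP' (g, 0))
    rw [graphA_adjoint] at this
    simpa [R] using this
  refine ⟨ContinuousLinearMap.fst ℂ HF HF ∘L R, ?_, ?_, fun g => ⟨(R g).2, h1 g, h2 g⟩⟩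
  · have e : ContinuousLinearMap.fst ℂ HF HF ∘L R =
        (1 / 2 : ℂ) • Kop + (bα ∘L R).smulRight vp + (bβ ∘L R).smulRight vm := by
      ext1 g
      exact eq_Kop_add (mem_graphA.1 (h1 g)).1 (mem_graphA.1 (h2 g)).1
    rw [e]
    exact ((isCompactOperator_Kop.smul (1 / 2 : ℂ)).add (isCompactOperator_rankOne _ _)).add
      (isCompactOperator_rankOne _ _)
  · intro g g'
    change ⟪(R g).1, g'⟫_ℂ = ⟪g, (R g').1⟫_ℂ
    have e1 := graphA_symm (h1 g) (h2 g')
    have e2 := graphA_symm (h2 g) (h1 g')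
    simp only [inner_sub_left, inner_sub_right] at e1 e2
    linear_combination -e1 - e2

/-! ### Completeness of the exponentials -/

lemma mem_span_of_eigenvector {θ l : ℝ} {f : HF} (h : (f, (l : ℂ) • f) ∈ graphA θ) :
    f ∈ Submodule.span ℂ (expHF '' eigs θ) := by
  by_cases hf : f = 0
  · rw [hf]; exact zero_mem _
  · obtain ⟨hl, c, rfl⟩ := eigenvector_eq h hf
    exact Submodule.smul_mem _ _ (Submodule.subset_span ⟨l, hl, rfl⟩)

/-- Here Af = k and A²f = cf, so symmetry gives c = (‖k‖/‖f‖)² = ν². For ν ≠ 0, f is the mean of f ±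
ν⁻¹k, which are eigenvectors for ±ν or zero; for ν = 0, k vanishes. -/
lemma mem_span_of_square_eigenvector {θ : ℝ} {f k : HF} {c : ℂ} (h1 : (f, k) ∈ graphA θ)
    (h2 : (k, c • f) ∈ graphA θ) : f ∈ Submodule.span ℂ (expHF '' eigs θ) := by
  by_cases hf : f = 0
  · rw [hf]; exact zero_mem _
  have hc : c * (‖f‖ : ℂ) ^ 2 = (‖k‖ : ℂ) ^ 2 := by
    have := graphA_symm h1 h2
    simp only [inner_smul_right] at this
    have e := fun v : HF => inner_self_eq_norm_sq_to_K (𝕜 := ℂ) v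
    rw [e, e] at this
    exact this.symm
  have hf' : (‖f‖ : ℂ) ≠ 0 := by simpa using hf
  obtain ⟨ν, hν⟩ : ∃ ν : ℝ, c = (ν : ℂ) ^ 2 := ⟨‖k‖ / ‖f‖, by
    push_cast
    rw [div_pow, ← hc, mul_div_assoc, div_self (pow_ne_zero 2 hf'), mul_one]⟩
  by_cases hν0 : ν = 0
  · have hk : k = 0 := by
      rw [hν, hν0] at hc
      simpa using hc.symm
    exact mem_span_of_eigenvector (l := 0) (by simpa [hk] using h1)
  · have hν0' : (ν : ℂ) ≠ 0 := by exact_mod_cast hν0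
    have hp : f + (ν : ℂ)⁻¹ • k ∈ Submodule.span ℂ (expHF '' eigs θ) := by
      refine mem_span_of_eigenvector (l := ν) ?_
      have := add_mem h1 (Submodule.smul_mem _ (ν : ℂ)⁻¹ h2)
      convert! this using 1
      refine Prod.ext rfl ?_
      simp only [Prod.snd_add, Prod.smul_snd, hν, smul_add, smul_smul]
      rw [mul_inv_cancel₀ hν0', sq, inv_mul_cancel_left₀ hν0', one_smul, add_comm]
    have hm : f - (ν : ℂ)⁻¹ • k ∈ Submodule.span ℂ (expHF '' eigs θ) := by
      refine mem_span_of_eigenvector (l := -ν) ?_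
      have := sub_mem h1 (Submodule.smul_mem _ (ν : ℂ)⁻¹ h2)
      convert! this using 1
      refine Prod.ext rfl ?_
      simp only [Prod.snd_sub, Prod.smul_snd, hν, smul_sub, smul_smul, Complex.ofReal_neg,
        neg_smul, neg_mul]
      rw [mul_inv_cancel₀ hν0', sq, inv_mul_cancel_left₀ hν0', one_smul]
      abel
    have := Submodule.smul_mem _ (1 / 2 : ℂ) (add_mem hp hm)
    convert this using 1
    module

lemma span_expHF_orthogonal (θ : ℝ) : (Submodule.span ℂ (expHF '' eigs θ))ᗮ = ⊥ := by
  obtain ⟨B, hB, hB', hBg⟩ := exists_square_resolvent θ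
  rw [← ContinuousLinearMap.orthogonalComplement_iSup_eigenspaces_eq_bot hB hB']
  refine le_antisymm (Submodule.orthogonal_le (iSup_le fun μ f hf => ?_)) ?_
  · have hf' : B f = μ • f := Module.End.mem_eigenspace_iff.1 hf
    obtain ⟨k, h1, h2⟩ := hBg f
    rw [hf'] at h1 h2
    -- For μ = 0, Bf = 0 forces f = 0; otherwise A²f = μ⁻¹(1 - μ)f.
    by_cases hμ : μ = 0
    · rw [hμ, zero_smul] at h1 h2
      rw [snd_eq_zero_of_mem_graphA h1, sub_zero] at h2
      rw [snd_eq_zero_of_mem_graphA h2]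
      exact zero_mem _
    · have h1' := Submodule.smul_mem _ μ⁻¹ h1
      have h2' := Submodule.smul_mem _ μ⁻¹ h2
      simp only [Prod.smul_mk, smul_smul, inv_mul_cancel₀ hμ, one_smul] at h1' h2'
      refine mem_span_of_square_eigenvector (c := μ⁻¹ * (1 - μ)) h1' ?_
      rwa [mul_smul, sub_smul, one_smul]
  · rw [ContinuousLinearMap.orthogonalComplement_iSup_eigenspaces_eq_bot hB hB']
    exact bot_le

lemma sqrt_mul_norm_expHF (l : ℝ) : Real.sqrt (2 / (l ^ 2 + 3)) * ‖expHF l‖ = 1 := by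
  rw [norm_expHF, ← Real.sqrt_mul (by positivity)]
  rw [div_mul_div_comm, mul_comm, div_self (by positivity), Real.sqrt_one]

/-- The normalized exponentials form an orthonormal basis. -/
lemma exists_hilbertBasis_expHF {θ : ℝ} {S : Set ℝ} (hS : S = eigs θ) :
    ∃ b : HilbertBasis S ℂ HF,
      ∀ l : S, b l = ((Real.sqrt (2 / ((l : ℝ) ^ 2 + 3)) : ℝ) : ℂ) • expHF l := by
  subst hS
  let v : eigs θ → HF := fun l => ((Real.sqrt (2 / ((l : ℝ) ^ 2 + 3)) : ℝ) : ℂ) • expHF l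
  have hv : Orthonormal ℂ v := by
    refine ⟨fun l => ?_, fun l m hlm => ?_⟩
    · rw [norm_smul, Complex.norm_real, Real.norm_of_nonneg (Real.sqrt_nonneg _),
        sqrt_mul_norm_expHF]
    · change ⟪v l, v m⟫_ℂ = 0
      simp only [v, inner_smul_left, inner_smul_right]
      rw [inner_expHF_eq_zero l.2 m.2 (fun h => hlm (Subtype.ext h)), mul_zero, mul_zero]
  have hsp : (Submodule.span ℂ (range v))ᗮ = ⊥ := by
    rw [← le_bot_iff, ← span_expHF_orthogonal θ]
    refine Submodule.orthogonal_le (Submodule.span_le.2 ?_)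
    rintro _ ⟨l, hl, rfl⟩
    have hne : ((Real.sqrt (2 / (l ^ 2 + 3)) : ℝ) : ℂ) ≠ 0 := by
      have : Real.sqrt (2 / (l ^ 2 + 3)) ≠ 0 := by positivity
      exact_mod_cast this
    have : expHF l = ((Real.sqrt (2 / (l ^ 2 + 3)) : ℝ) : ℂ)⁻¹ • v ⟨l, hl⟩ := by
      simp only [v, smul_smul, inv_mul_cancel₀ hne, one_smul]
    rw [SetLike.mem_coe, this]
    exact Submodule.smul_mem _ _ (Submodule.subset_span ⟨_, rfl⟩)
  exact ⟨HilbertBasis.mkOfOrthogonalEqBot hv hsp, fun l => by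
    rw [HilbertBasis.coe_mkOfOrthogonalEqBot]⟩

/-! ### The spectrum of `A θ` -/

lemma isClosed_eigs (θ : ℝ) : IsClosed (eigs θ) :=
  isClosed_eq (by fun_prop) (by fun_prop)

lemma hasSum_norm_inner_sq {ι : Type*} (b : HilbertBasis ι ℂ HF) (x : HF) :
    HasSum (fun i => ‖⟪b i, x⟫_ℂ‖ ^ 2) (‖x‖ ^ 2) := by
  have h := Complex.hasSum_re (b.hasSum_inner_mul_inner x x)
  rw [inner_self_eq_norm_sq_to_K] at h
  convert h using 1
  · ext i
    rw [← inner_conj_symm x, ← Complex.normSq_eq_conj_mul_self, Complex.ofReal_re,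
      Complex.normSq_eq_norm_sq]
  · norm_cast

/-- Away from the eigenvalues, `A θ - z` is bounded below. -/
lemma le_norm_sub_of_mem_graphA {θ d : ℝ} {z : ℂ} (hd : 0 ≤ d)
    (h : ∀ l ∈ eigs θ, d ≤ ‖(l : ℂ) - z‖) {p : HF × HF} (hp : p ∈ graphA θ) :
    d * ‖p.1‖ ≤ ‖p.2 - z • p.1‖ := by
  obtain ⟨b, hb⟩ := exists_hilbertBasis_expHF (θ := θ) rfl
  -- In the eigenbasis A - z multiplies the coefficient at λ by λ - z; Parseval then gives the
  -- bound.
  have hi : ∀ l : eigs θ, ⟪b l, p.2 - z • p.1⟫_ℂ = ((l : ℝ) - z) * ⟪b l, p.1⟫_ℂ := fun l => by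
    have := graphA_symm (expHF_mem_graphA.2 l.2) hp
    simp only [inner_smul_left, Complex.conj_ofReal] at this
    rw [hb, inner_smul_left, inner_smul_left, inner_sub_right, inner_smul_right, ← this]
    ring
  have h1 := (hasSum_norm_inner_sq b p.1).mul_left (d ^ 2)
  have h2 := hasSum_norm_inner_sq b (p.2 - z • p.1)
  have := hasSum_le (fun l => ?_) h1 h2
  · rw [← mul_pow] at this
    exact (sq_le_sq₀ (by positivity) (norm_nonneg _)).1 this
  · rw [hi, norm_mul, mul_pow]
    gcongr
    exact h l l.2

/-- The map (f, k) ↦ k - zf on the closed graph is bounded below, hence injective with closed range;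
its range contains every e_λ, so it is all of the space and the inverse is bounded. -/
lemma mem_resolventSet {θ : ℝ} {z : ℂ} (hz : z ∉ Complex.ofReal '' eigs θ) :
    z ∈ resolventSet (A θ) := by
  obtain ⟨d, hd, hball⟩ := Metric.isOpen_iff.1
    (Complex.isometry_ofReal.isClosedEmbedding.isClosedMap _ (isClosed_eigs θ)).isOpen_compl z hz
  have hdist : ∀ l ∈ eigs θ, d ≤ ‖(l : ℂ) - z‖ := fun l hl => by
    by_contra! hlt
    exact hball (show (l : ℂ) ∈ Metric.ball z d by rwa [Metric.mem_ball, dist_eq_norm])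
      ⟨l, hl, rfl⟩
  have hbd := fun (p : graphA θ) => le_norm_sub_of_mem_graphA hd.le hdist p.2
  let Φ : graphA θ →L[ℂ] HF := (ContinuousLinearMap.snd ℂ HF HF -
    z • ContinuousLinearMap.fst ℂ HF HF) ∘L (graphA θ).subtypeL
  have hΦ : ∀ p : graphA θ, Φ p = p.1.2 - z • p.1.1 := fun p => rfl
  have hC : (0 : ℝ) ≤ 1 + (1 + ‖z‖) / d := by positivity
  -- Since ‖f‖ ≤ ‖Φp‖/d and ‖k‖ ≤ ‖Φp‖ + ‖z‖‖f‖, the constant dominates both entries of the sup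
  -- norm.
  have hanti : AntilipschitzWith ⟨1 + (1 + ‖z‖) / d, hC⟩ Φ := by
    refine Φ.antilipschitz_of_bound fun p => ?_
    have h1 : ‖p.1.1‖ ≤ ‖Φ p‖ / d := by
      rw [le_div_iff₀ hd, mul_comm]; exact hbd p
    have h2 : ‖p.1.2‖ ≤ ‖Φ p‖ + ‖z‖ * (‖Φ p‖ / d) := by
      have e : p.1.2 = Φ p + z • p.1.1 := by rw [hΦ, sub_add_cancel]
      calc ‖p.1.2‖ ≤ ‖Φ p‖ + ‖z • p.1.1‖ := by rw [e]; exact norm_add_le _ _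
        _ ≤ _ := by rw [norm_smul]; gcongr
    have h3 : 0 ≤ ‖Φ p‖ / d := by positivity
    have h4 : 0 ≤ ‖z‖ * (‖Φ p‖ / d) := by positivity
    have e : (1 + (1 + ‖z‖) / d) * ‖Φ p‖ = ‖Φ p‖ + ‖Φ p‖ / d + ‖z‖ * (‖Φ p‖ / d) := by ring
    change ‖p.1‖ ≤ (1 + (1 + ‖z‖) / d) * ‖Φ p‖
    rw [e]
    exact max_le (by linarith [norm_nonneg (Φ p)]) (by linarith)
  have : CompleteSpace (graphA θ) := (isClosed_graphA θ).completeSpace_coe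
  have hcl : IsClosed (Φ.range : Set HF) := hanti.isClosed_range Φ.uniformContinuous
  have hker : Φ.ker = ⊥ := LinearMap.ker_eq_bot.2 hanti.injective
  have hrange : Φ.range = ⊤ := by
    have : CompleteSpace Φ.range := hcl.completeSpace_coe
    rw [← Submodule.orthogonal_eq_bot_iff, ← le_bot_iff, ← span_expHF_orthogonal θ]
    refine Submodule.orthogonal_le (Submodule.span_le.2 ?_)
    rintro _ ⟨l, hl, rfl⟩
    have hne : (l : ℂ) - z ≠ 0 := fun h0 => by
      have := hdist l hl
      rw [h0, norm_zero] at this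
      linarith
    refine ⟨((l : ℂ) - z)⁻¹ • ⟨_, expHF_mem_graphA.2 hl⟩, ?_⟩
    rw [map_smul]
    change ((l : ℂ) - z)⁻¹ • ((l : ℂ) • expHF l - z • expHF l) = _
    rw [← sub_smul, smul_smul, inv_mul_cancel₀ hne, one_smul]
  let e := ContinuousLinearEquiv.ofBijective Φ hker hrange
  refine ⟨ContinuousLinearMap.fst ℂ HF HF ∘L (graphA θ).subtypeL ∘L
    e.symm.toContinuousLinearMap, fun x => ?_, fun y => ?_⟩
  · have hx : ((x : HF), A θ x) ∈ graphA θ := A_graph θ ▸ LinearPMap.mem_graph (A θ) x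
    have : e ⟨_, hx⟩ = A θ x - z • (x : HF) := rfl
    rw [← this]
    simp
  · have hp : (e.symm y).1 ∈ (A θ).graph := (A_graph θ).symm ▸ (e.symm y).2
    obtain ⟨x, hx1, hx2⟩ := (LinearPMap.mem_graph_iff _).1 hp
    refine ⟨x, hx1, ?_⟩
    rw [hx1, hx2]
    exact e.apply_symm_apply y

lemma ofReal_mem_spec {θ l : ℝ} (hl : l ∈ eigs θ) : (l : ℂ) ∈ spec (A θ) := by
  rintro ⟨R, hR, -⟩
  have hp := expHF_mem_graphA.2 hl
  rw [← A_graph] at hp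
  obtain ⟨x, hx1, hx2⟩ := (LinearPMap.mem_graph_iff _).1 hp
  have := hR x
  rw [hx2, hx1, sub_self, map_zero] at this
  exact expHF_ne_zero l this.symm

lemma spec_A (θ : ℝ) : spec (A θ) = Complex.ofReal '' eigs θ := by
  refine Subset.antisymm (fun z hz => ?_) ?_
  · by_contra h
    exact hz (mem_resolventSet h)
  · rintro _ ⟨l, hl, rfl⟩
    exact ofReal_mem_spec hl

lemma Λ_eq (θ : ℝ) : Λ θ = eigs θ := by
  ext l
  rw [Λ, mem_ofPred_eq, spec_A, Complex.ofReal_injective.mem_set_image]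

/-! ### Distribution of the eigenvalues -/

/-- The phase `λ + 2 arctan λ`, whose values on the spectrum of `A θ` are `θ + 2πn`. -/
def phase (l : ℝ) : ℝ := l + 2 * Real.arctan l

lemma strictMono_phase : StrictMono phase := fun x y h => by
  have := Real.arctan_strictMono h
  unfold phase
  linarith

lemma abs_phase_sub_le (l : ℝ) : |phase l - l| ≤ Real.pi := by
  rw [phase, add_sub_cancel_left, abs_le]
  constructor <;> linarith [Real.neg_pi_div_two_lt_arctan l, Real.arctan_lt_pi_div_two l]

lemma surjective_phase : Function.Surjective phase := by
  have hc : Continuous phase := by unfold phase; fun_prop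
  refine hc.surjective ?_ ?_
  · refine tendsto_atTop_mono (fun l => ?_) (tendsto_atTop_add_const_right _ (-Real.pi) tendsto_id)
    have := (abs_le.1 (abs_phase_sub_le l)).1
    simp only [id]
    linarith
  · refine tendsto_atBot_mono (fun l => ?_) (tendsto_atBot_add_const_right _ Real.pi tendsto_id)
    have := (abs_le.1 (abs_phase_sub_le l)).2
    simp only [id]
    linarith

/-- With a = arctan λ, 1 ± iλ = e^{±ia}/cos a, so the eigenvalue equation reads e^{i(λ + 2a)} =
e^{iθ}. -/
lemma mem_eigs_of_phase {θ l : ℝ} {n : ℤ} (h : phase l = θ + n * (2 * Real.pi)) :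
    l ∈ eigs θ := by
  set a := Real.arctan l with ha
  have hc : (0 : ℝ) < Real.cos a := Real.cos_arctan_pos l
  have hs : Real.sin a = l * Real.cos a := by
    rw [← Real.tan_arctan l, ← ha, Real.tan_mul_cos hc.ne']
  have hc' : (Real.cos a : ℂ) ≠ 0 := by exact_mod_cast hc.ne'
  have h1 : Complex.exp (a * Complex.I) = Real.cos a * (1 + Complex.I * l) := by
    rw [Complex.exp_mul_I, ← Complex.ofReal_cos, ← Complex.ofReal_sin, hs]
    push_cast
    ring
  have h2 : Complex.exp (-(a * Complex.I)) = Real.cos a * (1 - Complex.I * l) := by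
    rw [← neg_mul, Complex.exp_mul_I, Complex.cos_neg, Complex.sin_neg, ← Complex.ofReal_cos,
      ← Complex.ofReal_sin, hs]
    push_cast
    ring
  have h3 : Complex.exp (a * Complex.I) * Complex.exp (Complex.I * l) =
      Complex.exp (θ * Complex.I) * Complex.exp (-(a * Complex.I)) := by
    rw [← Complex.exp_add, ← Complex.exp_add, Complex.exp_eq_exp_iff_exists_int]
    refine ⟨n, ?_⟩
    have h' : (l : ℂ) + 2 * a = θ + n * (2 * Real.pi) := by exact_mod_cast h
    linear_combination Complex.I * h'
  rw [h1, h2] at h3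
  rw [eigs, mem_ofPred_eq]
  refine mul_left_cancel₀ hc' ?_
  linear_combination h3

/-- An increasing sequence of eigenvalues whose gaps are smaller than `2π` and tend to `2π`. -/
lemma exists_eigs_seq (θ : ℝ) : ∃ u : ℕ → ℝ, (∀ n, u n ∈ eigs θ) ∧ (∀ n, u n < u (n + 1)) ∧
    (∀ n, u (n + 1) - u n < 2 * Real.pi) ∧
    Tendsto (fun n => u (n + 1) - u n) atTop (𝓝 (2 * Real.pi)) := by
  choose u hu using fun n : ℕ => surjective_phase (θ + n * (2 * Real.pi))
  have hlt : ∀ n, u n < u (n + 1) := fun n => by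
    rw [← strictMono_phase.lt_iff_lt, hu, hu]
    push_cast
    linarith [Real.pi_pos]
  have hgap : ∀ n, u (n + 1) - u n =
      2 * Real.pi - 2 * (Real.arctan (u (n + 1)) - Real.arctan (u n)) := fun n => by
    have h1 := hu n
    have h2 := hu (n + 1)
    simp only [phase] at h1 h2
    push_cast at h2
    linarith
  have htop : Tendsto u atTop atTop := by
    have : Tendsto (fun n : ℕ => (n : ℝ) * (2 * Real.pi) + (θ - Real.pi)) atTop atTop :=
      tendsto_atTop_add_const_right _ _
        (tendsto_natCast_atTop_atTop.atTop_mul_const Real.two_pi_pos)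
    refine tendsto_atTop_mono (fun n => ?_) this
    have := (abs_le.1 (abs_phase_sub_le (u n))).2
    rw [hu] at this
    linarith
  have harc : Tendsto (fun n => Real.arctan (u n)) atTop (𝓝 (Real.pi / 2)) :=
    (Real.tendsto_arctan_atTop.mono_right nhdsWithin_le_nhds).comp htop
  refine ⟨u, fun n => mem_eigs_of_phase (n := n) (by rw [hu]; simp), hlt, fun n => ?_, ?_⟩
  · have := Real.arctan_strictMono (hlt n)
    rw [hgap]
    linarith
  · simp only [hgap]
    have := (((harc.comp (tendsto_add_atTop_nat 1)).sub harc).const_mul 2).const_sub (2 * Real.pi)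
    simpa using this

lemma eigs_not_subset_progression (θ : ℝ) :
    ¬ ∃ a d : ℝ, ∀ l ∈ eigs θ, ∃ n : ℤ, l = a + n * d := by
  rintro ⟨a, d, h⟩
  obtain ⟨u, hu, hlt, hgap, hlim⟩ := exists_eigs_seq θ
  choose m hm using fun n => h (u n) (hu n)
  have hg : ∀ n, u (n + 1) - u n = ((m (n + 1) - m n : ℤ) : ℝ) * d := fun n => by
    rw [hm (n + 1), hm n]
    push_cast
    ring
  have hd : 0 < |d| := abs_pos.2 fun hd => by
    have := hg 0
    rw [hd, mul_zero] at this
    linarith [hlt 0]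
  -- Some gap lies within |d| of 2π, and a later one is strictly larger but still below 2π. Two
  -- multiples of d less than |d| apart coincide, a contradiction.
  obtain ⟨N, hN⟩ := (hlim.eventually (lt_mem_nhds (show 2 * Real.pi - |d| < 2 * Real.pi by
    linarith))).exists
  obtain ⟨n, hn⟩ := (hlim.eventually (lt_mem_nhds (hgap N))).exists
  have h1 : |(u (n + 1) - u n) - (u (N + 1) - u N)| < 1 * |d| := by
    rw [abs_of_pos (sub_pos.2 hn)]
    linarith [hgap n]
  rw [hg, hg, ← sub_mul, abs_mul] at h1
  have h2 := lt_of_mul_lt_mul_right h1 hd.le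
  rw [← Int.cast_sub, ← Int.cast_abs] at h2
  have h3 : |m (n + 1) - m n - (m (N + 1) - m N)| < 1 := by exact_mod_cast h2
  have h4 := Int.abs_lt_one_iff.1 h3
  have h5 : m (n + 1) - m n = m (N + 1) - m N := by omega
  rw [hg, hg, h5] at hn
  exact lt_irrefl _ hn

/-- The integral is (e^{i(m-l)} - 1)/(i(m-l)), and no multiple of 2π lies strictly between 0 and 2π.
-/
lemma integral_expFun_ne_zero {l m : ℝ} (h0 : 0 < m - l) (h1 : m - l < 2 * Real.pi) :
    ∫ x in (0 : ℝ)..1, conj (expFun l x) * expFun m x ≠ 0 := by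
  have e : ∀ x, conj (expFun l x) * expFun m x =
      Complex.exp (Complex.I * ((m - l : ℝ) : ℂ) * x) := fun x => by
    rw [expFun, expFun, ← Complex.exp_conj, ← Complex.exp_add]
    congr 1
    simp
    ring
  have hne : Complex.I * ((m - l : ℝ) : ℂ) ≠ 0 :=
    mul_ne_zero Complex.I_ne_zero (by exact_mod_cast h0.ne')
  simp only [e]
  rw [integral_exp_mul_complex hne]
  refine div_ne_zero ?_ hne
  simp only [Complex.ofReal_one, mul_one, Complex.ofReal_zero, mul_zero, Complex.exp_zero]
  rw [sub_ne_zero, Ne, Complex.exp_eq_one_iff]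
  rintro ⟨n, hn⟩
  have hn' : m - l = n * (2 * Real.pi) := by
    have : ((m - l : ℝ) : ℂ) = ((n * (2 * Real.pi) : ℝ) : ℂ) := by
      refine mul_left_cancel₀ Complex.I_ne_zero ?_
      rw [hn]
      push_cast
      ring
    exact_mod_cast this
  rw [hn'] at h0 h1
  have h2 : (0 : ℝ) < n := by
    by_contra! hcon
    nlinarith [Real.pi_pos]
  have h3 : (n : ℝ) < 1 := by
    by_contra! hcon
    nlinarith [Real.pi_pos]
  have h4 : 0 < n := by exact_mod_cast h2
  have h5 : n < 1 := by exact_mod_cast h3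
  omega

end ExpKernel

end

/-! ### The main theorem -/

theorem mainTheorem1 :
    -- the selfadjoint extensions of `-i D_F` are exactly the `A_θ`
    (∀ T : ExpKernel.HF →ₗ.[ℂ] ExpKernel.HF,
      (IsSelfAdjoint T ∧ ExpKernel.minusIDF ≤ T) ↔
        ∃ θ ∈ Set.Ico (0 : ℝ) (2 * Real.pi), T = ExpKernel.A θ) ∧
    -- the exponentials belong to `H_F`
    ∃ e : ℝ → ExpKernel.HF, (∀ (l : ℝ) (x : ExpKernel.Ω), e l x = ExpKernel.expFun l x) ∧
      ∀ θ ∈ Set.Ico (0 : ℝ) (2 * Real.pi),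
        -- the spectrum is real
        ExpKernel.spec (ExpKernel.A θ) = Complex.ofReal '' ExpKernel.Λ θ ∧
        -- orthogonality in `H_F`
        (∀ l ∈ ExpKernel.Λ θ, ∀ m ∈ ExpKernel.Λ θ, l ≠ m → inner ℂ (e l) (e m) = 0) ∧
        -- the normalized exponentials are an orthonormal basis of `H_F`
        (∃ b : HilbertBasis (ExpKernel.Λ θ) ℂ ExpKernel.HF,
          ∀ l : ExpKernel.Λ θ, b l = ((Real.sqrt (2 / ((l : ℝ) ^ 2 + 3)) : ℝ) : ℂ) • e l) ∧
        -- the frequencies do not lie on an arithmetic progression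
        (¬ ∃ a d : ℝ, ∀ l ∈ ExpKernel.Λ θ, ∃ n : ℤ, l = a + n * d) ∧
        -- the exponentials are not pairwise orthogonal in `L²(0,1)`
        ¬ ∀ l ∈ ExpKernel.Λ θ, ∀ m ∈ ExpKernel.Λ θ, l ≠ m →
          (∫ x in (0 : ℝ)..1,
            (starRingEnd ℂ) (ExpKernel.expFun l x) * ExpKernel.expFun m x) = 0 := by
  refine ⟨fun T => ⟨fun h => ExpKernel.exists_eq_A h.1 h.2, ?_⟩, ExpKernel.expHF,
    ExpKernel.expHF_apply, fun θ _ => ?_⟩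
  · rintro ⟨θ, -, rfl⟩
    exact ⟨ExpKernel.isSelfAdjoint_A θ, ExpKernel.minusIDF_le_A θ⟩
  · have hΛ := ExpKernel.Λ_eq θ
    refine ⟨by rw [ExpKernel.spec_A, hΛ], fun l hl m hm hlm => ?_,
      ExpKernel.exists_hilbertBasis_expHF hΛ, ?_, fun h => ?_⟩
    · exact ExpKernel.inner_expHF_eq_zero (hΛ ▸ hl) (hΛ ▸ hm) hlm
    · rw [hΛ]
      exact ExpKernel.eigs_not_subset_progression θ
    · obtain ⟨u, hu, hlt, hgap, -⟩ := ExpKernel.exists_eigs_seq θ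
      exact ExpKernel.integral_expFun_ne_zero (sub_pos.2 (hlt 0)) (hgap 0)
        (h _ (hΛ ▸ hu 0) _ (hΛ ▸ hu 1) (hlt 0).ne)
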